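/- **Setting.** A homogeneous-goods market consists of $n$ unit-demand buyers $B=\{1,\dots,n\}$, $m$ unit-supply sellers $S=\{1,\dots,m\}$, values $v_i\ge 0$ (buyer $i$ values every seller's good at $v_i$) and a bipartite graph $G$ of the buyer–seller pairs that can transact directly. A competitive equilibrium of $G$ is a pair of prices $p\in\mathbb R_{\ge0}^m$ and an allocation of goods along links of $G$, each buyer getting at most one good and each good being sold at most once, such that every buyer's utility (value minus price of her good, $0$ if she gets none) is at least $0$ and at least $v_i-p_j$ for every seller $j$ linked to her, and unsold goods have price $0$. For $P\subseteq S$ let $G(P)$ be $G$ with every seller of $P$ linked to all buyers, and let $p(P)$ be the coordinatewise maximum of the competitive price vectors of $G(P)$. For $\alpha\in[0,1]$, $P$ is a pure Platform Equilibrium if $(1-\alpha)p_j(P)\ge p_j(P\setminus\{j\})$ for all $j\in P$ and $p_j(P)\ge(1-\alpha)p_j(P\cup\{j\})$ for all $j\notin P$. **Algorithm 1.** Put $p_j^{\rm on}(P)=p_j(P\cup\{j\})$, $p_j^{\rm off}(P)=p_j(P\setminus\{j\})$, $\phi_j^P=(1-\alpha)p_j^{\rm on}(P)-p_j^{\rm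 off}(P)$. Start with $P=\emptyset$. While $P\ne S$, let $\hat\jmath$ be a seller with the lowest $p_j^{\rm off}(P)$ among the maximizers of $\phi_j^P$ over $j\in S\setminus P$ (remaining ties are broken arbitrarily); if $\phi_{\hat\jmath}^P\ge0$ add $\hat\jmath$ to $P$, otherwise stop. Output $P$. **Theorem.** In every homogeneous-goods market and for every $\alpha\in[0,1]$: for every $Q\subseteq S$ the set of competitive price vectors of $G(Q)$ has a greatest element, namely $p(Q)$; Algorithm 1 can be completed to an output from every set that it reaches; and every output of Algorithm 1 is a pure Platform Equilibrium. Moreover, an output of Algorithm 1, hence a pure Platform Equilibrium, can be computed in polynomial time: there are one program for a real-number random access machine (unit-cost addition, subtraction and comparison, and multiplication of a real number by an entry of the input; integers are only added, subtracted and compared) and one polynomial $q$ such that, on every input $(n,m,G,v,\alpha)$ with $v\ge 0$ and $\alpha\in[0,1]$, the program halts within $q(n+m)$ steps and outputs a set that is an output of Algorithm 1. -/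

import Mathlib

noncomputable section

namespace PlatformMarket

/-! ## Buyer-seller networks and competitive prices -/

/-- A market with buyers `Fin n`, sellers `Fin m`, unit-demand values `value i j ≥ 0` and a
bipartite graph `link` saying who can transact with whom. -/
structure Network (n m : ℕ) where
  value : Fin n → Fin m → ℝ
  value_nonneg : ∀ i j, 0 ≤ value i j
  link : Fin n → Fin m → Bool

/-- The homogeneous-goods market: buyer `i` values every good at `v i`. -/
def homogeneous {n m : ℕ} (v : Fin n → ℝ) (hv : ∀ i, 0 ≤ v i) (g : Fin n → Fin m → Bool) :
    Network n m where
  value i _ := v i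
  value_nonneg i _ := hv i
  link := g

/-- The utility of buyer `i` at prices `p` and allocation `a`. -/
def Network.utility {n m : ℕ} (N : Network n m) (p : Fin m → ℝ) (a : Fin n → Fin m → Bool)
    (i : Fin n) : ℝ :=
  ∑ j, if a i j = true then N.value i j - p j else 0

/-- Competitive (Walrasian) equilibrium. A buyer compares her outcome with the goods of the sellers
she is linked to (equivalently, a missing link is a value `0`). -/
structure Network.IsCompetitiveEquilibrium {n m : ℕ} (N : Network n m) (p : Fin m → ℝ)
    (a : Fin n → Fin m → Bool) : Prop where
  price_nonneg : ∀ j, 0 ≤ p j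
  respects_links : ∀ i j, a i j = true → N.link i j = true
  buyer_unit : ∀ i j j', a i j = true → a i j' = true → j = j'
  seller_unit : ∀ j i i', a i j = true → a i' j = true → i = i'
  preferred : ∀ i j, N.link i j = true → N.value i j - p j ≤ N.utility p a i
  utility_nonneg : ∀ i, 0 ≤ N.utility p a i
  unsold_free : ∀ j, (∀ i, a i j = false) → p j = 0

/-- The set of competitive price vectors. -/
def Network.competitivePrices {n m : ℕ} (N : Network n m) : Set (Fin m → ℝ) :=
  {p | ∃ a, N.IsCompetitiveEquilibrium p a}

/-- The maximum competitive price of the good of seller `j`. -/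
def Network.maxPrice {n m : ℕ} (N : Network n m) (j : Fin m) : ℝ :=
  sSup {x | ∃ p ∈ N.competitivePrices, x = p j}

/-! ## The platform -/

/-- The network formed when the sellers in `P` join the platform: they are linked to all buyers. -/
def Network.join {n m : ℕ} (N : Network n m) (P : Finset (Fin m)) : Network n m where
  value := N.value
  value_nonneg := N.value_nonneg
  link i j := decide (j ∈ P) || N.link i j

/-- The price of seller `j` when `P` is on the platform (maximum competitive prices clear the
market). -/
def Network.price {n m : ℕ} (N : Network n m) (P : Finset (Fin m)) (j : Fin m) : ℝ :=
  (N.join P).maxPrice j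

/-- `P` is a pure Platform Equilibrium at transaction fee fraction `α`: no seller gains by
unilaterally leaving or joining the platform. -/
def Network.IsPurePlatformEquilibrium {n m : ℕ} (N : Network n m) (α : ℝ)
    (P : Finset (Fin m)) : Prop :=
  (∀ j ∈ P, N.price (P.erase j) j ≤ (1 - α) * N.price P j) ∧
  (∀ j ∉ P, (1 - α) * N.price (insert j P) j ≤ N.price P j)

/-! ## The greedy algorithm -/

/-- The price of `j` on the platform, given that the other sellers of `P` are on it. -/
def Network.onPrice {n m : ℕ} (N : Network n m) (P : Finset (Fin m)) (j : Fin m) : ℝ :=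
  N.price (insert j P) j

/-- The price of `j` off the platform, given that the other sellers of `P` are on it. -/
def Network.offPrice {n m : ℕ} (N : Network n m) (P : Finset (Fin m)) (j : Fin m) : ℝ :=
  N.price (P.erase j) j

/-- The on-platform gain of seller `j`. -/
def Network.gain {n m : ℕ} (N : Network n m) (α : ℝ) (P : Finset (Fin m)) (j : Fin m) : ℝ :=
  (1 - α) * N.onPrice P j - N.offPrice P j

/-- The sellers outside `P` with the largest on-platform gain. -/
def Network.gainMaximizers {n m : ℕ} (N : Network n m) (α : ℝ) (P : Finset (Fin m)) :
    Set (Fin m) :=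
  {j | j ∉ P ∧ ∀ k ∉ P, N.gain α P k ≤ N.gain α P j}

/-- `j` may be selected next: it has the lowest off-platform price among the gain maximizers.
Ties that remain may be broken in any way. -/
def Network.IsSelected {n m : ℕ} (N : Network n m) (α : ℝ) (P : Finset (Fin m))
    (j : Fin m) : Prop :=
  j ∈ N.gainMaximizers α P ∧ ∀ k ∈ N.gainMaximizers α P, N.offPrice P j ≤ N.offPrice P k

/-- One pass through the loop: the selected seller joins if her gain is nonnegative. -/
def Network.GreedyStep {n m : ℕ} (N : Network n m) (α : ℝ) (P P' : Finset (Fin m)) : Prop :=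
  ∃ j, N.IsSelected α P j ∧ 0 ≤ N.gain α P j ∧ P' = insert j P

/-- `P` is an output of a run of the greedy algorithm: it is reached from `∅`, and the loop is left
at `P`, either since all sellers joined or since the selected seller has a negative gain. -/
def Network.IsGreedyOutput {n m : ℕ} (N : Network n m) (α : ℝ) (P : Finset (Fin m)) : Prop :=
  Relation.ReflTransGen (N.GreedyStep α) ∅ P ∧
  (P = Finset.univ ∨ ∃ j, N.IsSelected α P j ∧ N.gain α P j < 0)

/-! ## A machine model

A random access machine with arrays of natural numbers and arrays of real numbers, programmed in a
while language. Array `a` is a fixed name in the program; cells of arrays are addressed by computed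
indices. Naturals can only be added and subtracted. Reals can be added, subtracted, compared, and
multiplied by an entry of the (read-only) real input. There is no multiplication of
two computed numbers, so in `t` steps a number can only reach a bit-length polynomial in `t` and in
the bit-length of the input. Every executed assignment or test costs one step (the sizes of the
expressions are constants of the program). -/

/-- Expressions for natural numbers. -/
inductive NatExpr : Type
  | const (c : ℕ) : NatExpr
  | get (a : ℕ) (idx : NatExpr) : NatExpr
  | add (e₁ e₂ : NatExpr) : NatExpr
  | sub (e₁ e₂ : NatExpr) : NatExpr

/-- Expressions for real numbers; `input idx` is an entry of the real input, and `scale idx r`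
multiplies `r` by such an entry. -/
inductive RealExpr : Type
  | const (c : ℤ) : RealExpr
  | input (idx : NatExpr) : RealExpr
  | get (a : ℕ) (idx : NatExpr) : RealExpr
  | add (r₁ r₂ : RealExpr) : RealExpr
  | sub (r₁ r₂ : RealExpr) : RealExpr
  | scale (idx : NatExpr) (r : RealExpr) : RealExpr

/-- Tests. -/
inductive Test : Type
  | natLE (e₁ e₂ : NatExpr) : Test
  | realLE (r₁ r₂ : RealExpr) : Test
  | not (b : Test) : Test
  | and (b₁ b₂ : Test) : Test

/-- Programs. -/
inductive Program : Type
  | skip : Program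
  | setNat (a : ℕ) (idx e : NatExpr) : Program
  | setReal (a : ℕ) (idx : NatExpr) (r : RealExpr) : Program
  | seq (p q : Program) : Program
  | ite (b : Test) (p q : Program) : Program
  | while (b : Test) (p : Program) : Program

/-- The memory: `nat a k` and `real a k` are the `k`-th cells of the arrays named `a`. -/
structure Memory where
  nat : ℕ → ℕ → ℕ
  real : ℕ → ℕ → ℝ

def NatExpr.eval (s : Memory) : NatExpr → ℕ
  | const c => c
  | get a idx => s.nat a (idx.eval s)
  | add e₁ e₂ => e₁.eval s + e₂.eval s
  | sub e₁ e₂ => e₁.eval s - e₂.eval s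

def RealExpr.eval (inp : ℕ → ℝ) (s : Memory) : RealExpr → ℝ
  | const c => (c : ℝ)
  | input idx => inp (idx.eval s)
  | get a idx => s.real a (idx.eval s)
  | add r₁ r₂ => r₁.eval inp s + r₂.eval inp s
  | sub r₁ r₂ => r₁.eval inp s - r₂.eval inp s
  | scale idx r => inp (idx.eval s) * r.eval inp s

def Test.Holds (inp : ℕ → ℝ) (s : Memory) : Test → Prop
  | natLE e₁ e₂ => e₁.eval s ≤ e₂.eval s
  | realLE r₁ r₂ => r₁.eval inp s ≤ r₂.eval inp s
  | not b => ¬ b.Holds inp s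
  | and b₁ b₂ => b₁.Holds inp s ∧ b₂.Holds inp s

def Memory.setNat (s : Memory) (a k x : ℕ) : Memory where
  nat := Function.update s.nat a (Function.update (s.nat a) k x)
  real := s.real

def Memory.setReal (s : Memory) (a k : ℕ) (x : ℝ) : Memory where
  nat := s.nat
  real := Function.update s.real a (Function.update (s.real a) k x)

/-- `Runs inp p s t s'`: on real input `inp`, the program `p` started in memory `s` halts after
exactly `t` steps in memory `s'`. -/
inductive Runs (inp : ℕ → ℝ) : Program → Memory → ℕ → Memory → Prop
  | skip (s : Memory) : Runs inp Program.skip s 1 s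
  | setNat (a : ℕ) (idx e : NatExpr) (s : Memory) :
      Runs inp (Program.setNat a idx e) s 1 (s.setNat a (idx.eval s) (e.eval s))
  | setReal (a : ℕ) (idx : NatExpr) (r : RealExpr) (s : Memory) :
      Runs inp (Program.setReal a idx r) s 1 (s.setReal a (idx.eval s) (r.eval inp s))
  | seq {p q : Program} {s s' s'' : Memory} {t t' : ℕ} :
      Runs inp p s t s' → Runs inp q s' t' s'' → Runs inp (Program.seq p q) s (t + t') s''
  | ite_true {b : Test} {p q : Program} {s s' : Memory} {t : ℕ} :
      b.Holds inp s → Runs inp p s t s' → Runs inp (Program.ite b p q) s (t + 1) s'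
  | ite_false {b : Test} {p q : Program} {s s' : Memory} {t : ℕ} :
      ¬ b.Holds inp s → Runs inp q s t s' → Runs inp (Program.ite b p q) s (t + 1) s'
  | while_true {b : Test} {p : Program} {s s' s'' : Memory} {t t' : ℕ} :
      b.Holds inp s → Runs inp p s t s' → Runs inp (Program.while b p) s' t' s'' →
      Runs inp (Program.while b p) s (t + t' + 1) s''
  | while_false {b : Test} {p : Program} {s : Memory} :
      ¬ b.Holds inp s → Runs inp (Program.while b p) s 1 s

/-- The real input: the fee `α`, then the values of the buyers. -/
def realInput {n : ℕ} (α : ℝ) (v : Fin n → ℝ) : ℕ → ℝ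
  | 0 => α
  | k + 1 => if h : k < n then v ⟨k, h⟩ else 0

/-- The combinatorial input, in the initial memory: array `0` holds `n, m`, array `1` holds the
`n × m` bits of the graph row by row, and all other cells are `0`. -/
def initialMemory {n m : ℕ} (g : Fin n → Fin m → Bool) : Memory where
  nat
    | 0, 0 => n
    | 0, 1 => m
    | 1, k =>
        if h : k < n * m then
          (g (finProdFinEquiv.symm ⟨k, h⟩).1 (finProdFinEquiv.symm ⟨k, h⟩).2).toNat
        else 0
    | _, _ => 0
  real _ _ := 0

/-- The set of sellers that is output: those whose cell in array `2` is nonzero. -/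
def outputSet (m : ℕ) (s : Memory) : Finset (Fin m) :=
  Finset.univ.filter fun j => s.nat 2 (j : ℕ) ≠ 0

end PlatformMarket

end

/-! Let $U_x$ be the set of buyers of value at least $x$. The maximum competitive price of seller
$j$ is the largest $x>0$ at which every maximum matching between $U_x$ and the sellers uses $j$
(`Essential`), or $0$ if there is none. Ranks are taken in König's form, as minimum vertex covers,
so that submodularity follows by uncrossing covers (`matchRank_submodular`). Hence a seller stays
essential when buyers are added or rival sellers removed (`Essential.mono`). An equilibrium in which
$j$ costs $x>0$ exhibits a minimum cover of $U_x$ containing $j$ (`competitive_le_critical`).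
Conversely, the matroid greedy algorithm gives one matching that is maximum on every $U_x$ at once,
and complementary slackness against the minimum covers shows that the critical prices are
competitive (`critical_mem_competitivePrices`).

In $G(P)$ the rank of $U$ is $\min(|U|, |P| + r)$, where $r$ is the rank of $U$ off the platform
(`matchRank_joinLink`). So all members of $P$ have the same price, and an outsider's price reaches
$x$ iff the platform price condition holds at $x$ and she is essential off the platform. The price
of an outsider after joining is the maximum of her present price and a number that does not depend
on her. The gain is therefore antitone in the present price, and the algorithm just picks an
outsider of lowest price (`isSelected_iff`). For $\alpha>0$, unless the platform price is $0$,
`GreedyInvariant` carries the off-platform price $y$ of the last seller to join: above $y$ the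
sellers of $P$ are redundant off the platform, so a member who leaves gets at most $y$, while $y$ is
at most $1-\alpha$ times the platform price. For $\alpha=0$ it suffices that joining never lowers a
price. Outsiders do not want to join because the largest gain is negative on exit.

For the running time, a price needs only the ranks of at most $n$ level sets, with and without the
seller. An auction with $m+1$ positive levels for $m$ goods computes a rank: some level is
unoccupied, and this gap yields a cover no larger than the matching (`count_add_matchRank`).
Invariants and variants of the loops then verify the program, with time bounds that are polynomial
expressions. -/

namespace PlatformMarket

/-! ## The rank of a set of buyers in a bipartite graph -/

section Rank

set_option linter.unusedSectionVars false

variable {β σ : Type*} [DecidableEq β] [DecidableEq σ]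

/-- The sellers in `T` linked to some buyer in `A`. -/
def neighbors (L : β → σ → Bool) (T : Finset σ) (A : Finset β) : Finset σ :=
  T.filter fun t => ∃ a ∈ A, L a t = true

theorem mem_neighbors {L : β → σ → Bool} {T : Finset σ} {A : Finset β} {t : σ} :
    t ∈ neighbors L T A ↔ t ∈ T ∧ ∃ a ∈ A, L a t = true := by
  simp [neighbors]

/-- The size of the vertex cover of `U`, `T` given by `U \ A` and the neighbors of `A`. -/
def coverCard (L : β → σ → Bool) (U : Finset β) (T : Finset σ) (A : Finset β) : ℕ :=
  (U \ A).card + (neighbors L T A).card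

/-- The maximum size of a matching between `U` and `T`, in the form given by the theorem of König:
the minimum size of a vertex cover. -/
noncomputable def matchRank (L : β → σ → Bool) (U : Finset β) (T : Finset σ) : ℕ :=
  sInf (Set.range (coverCard L U T))

theorem matchRank_le (L : β → σ → Bool) (U : Finset β) (T : Finset σ) (A : Finset β) :
    matchRank L U T ≤ coverCard L U T A :=
  Nat.sInf_le ⟨A, rfl⟩

theorem exists_coverCard_eq (L : β → σ → Bool) (U : Finset β) (T : Finset σ) :
    ∃ A, coverCard L U T A = matchRank L U T :=
  Nat.sInf_mem (s := Set.range (coverCard L U T)) ⟨_, ∅, rfl⟩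

/-- Uncrossing of two covers. Intersecting the buyer sides while uniting the seller sides (and vice
versa) is what makes the rank submodular in buyers against reversed sellers. -/
theorem coverCard_submodular (L : β → σ → Bool) (U U' : Finset β) (T T' : Finset σ)
    (A A' : Finset β) :
    coverCard L (U ∩ U') (T ∪ T') (A ∩ A') + coverCard L (U ∪ U') (T ∩ T') (A ∪ A') ≤
      coverCard L U T A + coverCard L U' T' A' := by
  have h1 : ((U ∩ U') \ (A ∩ A')).card + ((U ∪ U') \ (A ∪ A')).card ≤
      (U \ A).card + (U' \ A').card := by
    rw [← Finset.card_union_add_card_inter, ← Finset.card_union_add_card_inter (U \ A)]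
    refine add_le_add (Finset.card_le_card fun i hi => ?_) (Finset.card_le_card fun i hi => ?_)
    · simp only [Finset.mem_union, Finset.mem_sdiff, Finset.mem_inter] at hi ⊢
      tauto
    · simp only [Finset.mem_union, Finset.mem_sdiff, Finset.mem_inter] at hi ⊢
      tauto
  have h2 : (neighbors L (T ∪ T') (A ∩ A')).card + (neighbors L (T ∩ T') (A ∪ A')).card ≤
      (neighbors L T A).card + (neighbors L T' A').card := by
    rw [← Finset.card_union_add_card_inter, ← Finset.card_union_add_card_inter (neighbors L T A)]
    refine add_le_add (Finset.card_le_card fun t ht => ?_) (Finset.card_le_card fun t ht => ?_)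
    · simp only [Finset.mem_union, mem_neighbors, Finset.mem_inter] at ht ⊢
      rcases ht with ⟨h | h, a, ha, hl⟩ | ⟨h, a, ha | ha, hl⟩
      · exact Or.inl ⟨h, a, ha.1, hl⟩
      · exact Or.inr ⟨h, a, ha.2, hl⟩
      · exact Or.inl ⟨h.1, a, ha, hl⟩
      · exact Or.inr ⟨h.2, a, ha, hl⟩
    · simp only [Finset.mem_union, mem_neighbors, Finset.mem_inter] at ht ⊢
      obtain ⟨⟨-, b, hb, hbl⟩, h, -⟩ := ht
      exact ⟨⟨h.1, b, hb.1, hbl⟩, h.2, b, hb.2, hbl⟩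
  simp only [coverCard]
  omega

theorem matchRank_submodular (L : β → σ → Bool) (U U' : Finset β) (T T' : Finset σ) :
    matchRank L (U ∩ U') (T ∪ T') + matchRank L (U ∪ U') (T ∩ T') ≤
      matchRank L U T + matchRank L U' T' := by
  obtain ⟨A, hA⟩ := exists_coverCard_eq L U T
  obtain ⟨A', hA'⟩ := exists_coverCard_eq L U' T'
  have := coverCard_submodular L U U' T T' A A'
  have h1 := matchRank_le L (U ∩ U') (T ∪ T') (A ∩ A')
  have h2 := matchRank_le L (U ∪ U') (T ∩ T') (A ∪ A')
  omega

theorem neighbors_mono {L : β → σ → Bool} {T T' : Finset σ} (h : T ⊆ T') (A : Finset β) :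
    neighbors L T A ⊆ neighbors L T' A :=
  Finset.filter_subset_filter _ h

theorem matchRank_mono {L : β → σ → Bool} {U U' : Finset β} {T T' : Finset σ} (hU : U ⊆ U')
    (hT : T ⊆ T') : matchRank L U T ≤ matchRank L U' T' := by
  obtain ⟨A, hA⟩ := exists_coverCard_eq L U' T'
  rw [← hA]
  exact (matchRank_le L U T A).trans (add_le_add
    (Finset.card_le_card (Finset.sdiff_subset_sdiff hU le_rfl))
    (Finset.card_le_card (neighbors_mono hT A)))

theorem matchRank_le_card (L : β → σ → Bool) (U : Finset β) (T : Finset σ) :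
    matchRank L U T ≤ U.card := by
  simpa [coverCard, neighbors] using matchRank_le L U T ∅

theorem matchRank_insert_buyer_le (L : β → σ → Bool) (U : Finset β) (T : Finset σ) (b : β) :
    matchRank L (insert b U) T ≤ matchRank L U T + 1 := by
  obtain ⟨A, hA⟩ := exists_coverCard_eq L U T
  have h1 := matchRank_le L (insert b U) T A
  have h2 : (insert b U \ A).card ≤ (U \ A).card + 1 := by
    refine (Finset.card_le_card (t := insert b (U \ A)) fun i hi => ?_).trans
      (Finset.card_insert_le _ _)
    simp only [Finset.mem_insert, Finset.mem_sdiff] at hi ⊢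
    tauto
  simp only [coverCard] at *
  omega

theorem matchRank_le_erase_seller (L : β → σ → Bool) (U : Finset β) (T : Finset σ) (t : σ) :
    matchRank L U T ≤ matchRank L U (T.erase t) + 1 := by
  obtain ⟨A, hA⟩ := exists_coverCard_eq L U (T.erase t)
  have h1 := matchRank_le L U T A
  have h2 : (neighbors L T A).card ≤ (neighbors L (T.erase t) A).card + 1 := by
    refine (Finset.card_le_card (t := insert t (neighbors L (T.erase t) A)) fun i hi => ?_).trans
      (Finset.card_insert_le _ _)
    simp only [Finset.mem_insert, mem_neighbors, Finset.mem_erase] at hi ⊢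
    tauto
  simp only [coverCard] at *
  omega

/-- Seller `t` is in every maximum matching between `U` and `T`. -/
def Essential (L : β → σ → Bool) (U : Finset β) (T : Finset σ) (t : σ) : Prop :=
  matchRank L U (T.erase t) < matchRank L U T

/-- By submodularity for the pairs `(U, T.erase t)` and `(U', T')`, the marginal contribution of a
seller can only grow with more buyers and fewer rivals. -/
theorem Essential.mono {L : β → σ → Bool} {U U' : Finset β} {T T' : Finset σ} {t : σ}
    (h : Essential L U T t) (hU : U ⊆ U') (hT : T' ⊆ T) (ht : t ∈ T') : Essential L U' T' t := by
  have key := matchRank_submodular L U U' (T.erase t) T'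
  have e1 : T.erase t ∪ T' = T := by
    ext s
    simp only [Finset.mem_union, Finset.mem_erase]
    constructor
    · rintro (h | h)
      · exact h.2
      · exact hT h
    · intro h
      by_cases hs : s = t
      · exact Or.inr (hs ▸ ht)
      · exact Or.inl ⟨hs, h⟩
  have e2 : T.erase t ∩ T' = T'.erase t := by
    ext s
    simp only [Finset.mem_inter, Finset.mem_erase]
    exact ⟨fun h => ⟨h.1.1, h.2⟩, fun h => ⟨⟨h.1, hT h.2⟩, h.2⟩⟩
  rw [Finset.inter_eq_left.mpr hU, Finset.union_eq_right.mpr hU, e1, e2] at key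
  unfold Essential at *
  omega

/-- A cover using `t` becomes smaller by one when `t` is deleted; a cover that does not use `t`
keeps its size. This turns essentiality into a statement about minimum covers, to which
complementary slackness applies. -/
theorem essential_iff_exists {L : β → σ → Bool} {U : Finset β} {T : Finset σ} {t : σ} :
    Essential L U T t ↔
      ∃ A, coverCard L U T A = matchRank L U T ∧ t ∈ neighbors L T A := by
  have hn : ∀ A, neighbors L (T.erase t) A = (neighbors L T A).erase t := by
    intro A
    ext s
    simp only [mem_neighbors, Finset.mem_erase]
    tauto
  constructor
  · intro h
    obtain ⟨A, hA⟩ := exists_coverCard_eq L U (T.erase t)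
    have h1 := matchRank_le L U T A
    unfold Essential at h
    simp only [coverCard, hn] at hA h1 ⊢
    by_cases ht : t ∈ neighbors L T A
    · have := Finset.card_erase_add_one ht
      exact ⟨A, by omega, ht⟩
    · rw [Finset.erase_eq_of_notMem ht] at hA
      omega
  · rintro ⟨A, hA, ht⟩
    have h1 := matchRank_le L U (T.erase t) A
    have := Finset.card_erase_add_one ht
    unfold Essential
    simp only [coverCard, hn] at hA h1 ⊢
    omega

/-- The size of a matching is at most that of a vertex cover. -/
theorem card_le_coverCard {L : β → σ → Bool} {U I : Finset β} {T : Finset σ} (f : β → σ)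
    (hI : I ⊆ U) (hf : ∀ i ∈ I, f i ∈ T ∧ L i (f i) = true) (hinj : Set.InjOn f I)
    (A : Finset β) : I.card ≤ coverCard L U T A := by
  rw [← Finset.card_sdiff_add_card_inter I A]
  refine add_le_add (Finset.card_le_card (Finset.sdiff_subset_sdiff hI le_rfl)) ?_
  refine Finset.card_le_card_of_injOn f (fun i hi => ?_) (hinj.mono (by simp))
  simp only [Finset.coe_inter, Set.mem_inter_iff, Finset.mem_coe] at hi
  exact mem_neighbors.mpr ⟨(hf i hi.1).1, i, hi.2, (hf i hi.1).2⟩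

/-- Hall's theorem for a set of buyers of full rank. -/
theorem exists_matching_of_matchRank_eq {L : β → σ → Bool} {I : Finset β} {T : Finset σ}
    (h : matchRank L I T = I.card) :
    ∃ f : I → σ, Function.Injective f ∧ ∀ i, f i ∈ T ∧ L i (f i) = true := by
  have hall := (Finset.all_card_le_biUnion_card_iff_exists_injective
    (fun i : I => T.filter fun t => L i t = true)).mp ?_
  · obtain ⟨f, hf, hm⟩ := hall
    exact ⟨f, hf, fun i => by simpa using hm i⟩
  · intro s
    -- The cover given by `s` has size at least `I.card`, and its buyer part has size `I.card -
    -- s.card`, so Hall's condition for `s` is what remains.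
    have h1 := matchRank_le L I T (s.map (Function.Embedding.subtype _))
    have hsub : s.map (Function.Embedding.subtype _) ⊆ I := by
      intro i hi
      simp only [Finset.mem_map, Function.Embedding.coe_subtype] at hi
      obtain ⟨a, -, rfl⟩ := hi
      exact a.2
    have h2 := Finset.card_sdiff_add_card_eq_card hsub
    rw [Finset.card_map] at h2
    have h3 : neighbors L T (s.map (Function.Embedding.subtype _)) ⊆
        s.biUnion fun i : I => T.filter fun t => L i t = true := by
      intro t ht
      obtain ⟨htT, a, ha, hl⟩ := mem_neighbors.mp ht
      simp only [Finset.mem_map, Function.Embedding.coe_subtype] at ha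
      obtain ⟨a', ha', rfl⟩ := ha
      simp only [Finset.mem_biUnion, Finset.mem_filter]
      exact ⟨a', ha', htT, hl⟩
    have h4 := Finset.card_le_card h3
    simp only [coverCard] at h1
    omega

/-- The matroid greedy algorithm: an independent set that is a basis of every upper level set. -/
theorem exists_simultaneous_basis (L : β → σ → Bool) (T : Finset σ) (v : β → ℝ) (s : Finset β) :
    ∃ I ⊆ s, matchRank L I T = I.card ∧
      ∀ x, (I.filter (x ≤ v ·)).card = matchRank L (s.filter (x ≤ v ·)) T := by
  -- Buyers arrive in order of decreasing value. A new buyer `a` leaves the levels above `v a`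
  -- unchanged, and every level at or below `v a` contains all buyers seen so far.
  induction s using Finset.induction_on_min_value v with
  | empty =>
    refine ⟨∅, le_rfl, ?_, fun x => ?_⟩
    · simpa using matchRank_le_card L ∅ T
    · simpa using ((matchRank_le_card L ∅ T).antisymm (Nat.zero_le _)).symm
  | insert a s has hmin ih =>
    obtain ⟨I, hIs, hI, hlev⟩ := ih
    have haI : a ∉ I := fun h => has (hIs h)
    have hsame : ∀ x, v a < x → (insert a s).filter (x ≤ v ·) = s.filter (x ≤ v ·) := by
      intro x hx
      rw [Finset.filter_insert, if_neg (not_le.mpr hx)]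
    have hall : ∀ x, x ≤ v a → (insert a s).filter (x ≤ v ·) = insert a s ∧
        s.filter (x ≤ v ·) = s ∧ I.filter (x ≤ v ·) = I := by
      intro x hx
      refine ⟨Finset.filter_true_of_mem fun i hi => ?_, Finset.filter_true_of_mem fun i hi => ?_,
        Finset.filter_true_of_mem fun i hi => ?_⟩
      · rcases Finset.mem_insert.mp hi with rfl | hi
        · exact hx
        · exact hx.trans (hmin i hi)
      · exact hx.trans (hmin i hi)
      · exact hx.trans (hmin i (hIs hi))
    have hIcard : I.card = matchRank L s T := by
      have := hlev (v a)
      rwa [(hall _ le_rfl).2.1, (hall _ le_rfl).2.2] at this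
    have hstep := matchRank_insert_buyer_le L s T a
    have hmono : matchRank L s T ≤ matchRank L (insert a s) T :=
      matchRank_mono (Finset.subset_insert a s) le_rfl
    by_cases hc : matchRank L (insert a s) T = matchRank L s T
    · refine ⟨I, hIs.trans (Finset.subset_insert a s), hI, fun x => ?_⟩
      rcases lt_or_ge (v a) x with hx | hx
      · rw [hsame x hx, hlev]
      · rw [(hall x hx).1, (hall x hx).2.2, hc, hIcard]
    · refine ⟨insert a I, Finset.insert_subset_insert a hIs, ?_, fun x => ?_⟩
      -- Since `I` and `s` have the same rank, submodularity transfers the increase caused by `a`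
      -- from `s` to `I`.
      · have hsub := matchRank_submodular L (insert a I) s T T
        have e1 : insert a I ∩ s = I := by
          rw [Finset.insert_inter_of_notMem has, Finset.inter_eq_left.mpr hIs]
        have e2 : insert a I ∪ s = insert a s := by
          rw [Finset.insert_union, Finset.union_eq_right.mpr hIs]
        rw [e1, e2, Finset.union_self, Finset.inter_self] at hsub
        have := matchRank_le_card L (insert a I) T
        rw [Finset.card_insert_of_notMem haI] at this ⊢
        omega
      · rcases lt_or_ge (v a) x with hx | hx
        · rw [hsame x hx, Finset.filter_insert, if_neg (not_le.mpr hx), hlev]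
        · rw [(hall x hx).1, Finset.filter_insert, if_pos hx, (hall x hx).2.2,
            Finset.card_insert_of_notMem haI]
          omega

end Rank

/-! ## Competitive equilibria of homogeneous-goods markets -/

/-- The buyers of value at least `x`. -/
noncomputable def levelSet {n : ℕ} (v : Fin n → ℝ) (x : ℝ) : Finset (Fin n) :=
  have := Classical.decPred fun i => x ≤ v i
  Finset.univ.filter fun i => x ≤ v i

theorem mem_levelSet {n : ℕ} {v : Fin n → ℝ} {x : ℝ} {i : Fin n} :
    i ∈ levelSet v x ↔ x ≤ v i := by
  simp [levelSet]

theorem levelSet_anti {n : ℕ} (v : Fin n → ℝ) {x y : ℝ} (h : x ≤ y) :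
    levelSet v y ⊆ levelSet v x := fun _ hi =>
  mem_levelSet.mpr (h.trans (mem_levelSet.mp hi))

/-- `r` is the largest value of a buyer at whose level seller `j` is essential, or `0`. -/
structure IsCritical {n m : ℕ} (v : Fin n → ℝ) (L : Fin n → Fin m → Bool) (j : Fin m)
    (r : ℝ) : Prop where
  nonneg : 0 ≤ r
  attained : r = 0 ∨ Essential L (levelSet v r) Finset.univ j
  upper : ∀ i, Essential L (levelSet v (v i)) Finset.univ j → v i ≤ r

/-- Essentiality is downward closed in the level, so the critical value is a threshold. All later
comparisons of prices go through this equivalence; at `x = 0` it may fail, hence `0 < x`. -/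
theorem IsCritical.le_iff {n m : ℕ} {v : Fin n → ℝ} {L : Fin n → Fin m → Bool} {j : Fin m}
    {r : ℝ} (h : IsCritical v L j r) {x : ℝ} (hx : 0 < x) :
    x ≤ r ↔ Essential L (levelSet v x) Finset.univ j := by
  constructor
  · intro hxr
    rcases h.attained with h0 | he
    · linarith
    · exact he.mono (levelSet_anti v hxr) le_rfl (Finset.mem_univ j)
  · intro he
    have hne : (levelSet v x).Nonempty := by
      by_contra hne
      rw [Finset.not_nonempty_iff_eq_empty] at hne
      have := matchRank_le_card L (levelSet v x) Finset.univ
      rw [hne, Finset.card_empty] at this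
      unfold Essential at he
      rw [hne] at he
      omega
    -- The level set at `x` is also the level set at the lowest value occurring in it, and `upper`
    -- speaks only of values of buyers.
    obtain ⟨i, hi, hmin⟩ := Finset.exists_min_image _ v hne
    have heq : levelSet v (v i) = levelSet v x :=
      (levelSet_anti v (mem_levelSet.mp hi)).antisymm fun k hk =>
        mem_levelSet.mpr (hmin k hk)
    exact (mem_levelSet.mp hi).trans (h.upper i (heq ▸ he))

theorem exists_isCritical {n m : ℕ} {v : Fin n → ℝ} (hv : ∀ i, 0 ≤ v i)
    (L : Fin n → Fin m → Bool) (j : Fin m) : ∃ r, IsCritical v L j r := by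
  classical
  by_cases hne : (Finset.univ.filter
      fun i => Essential L (levelSet v (v i)) Finset.univ j).Nonempty
  · obtain ⟨i, hi, hmax⟩ := Finset.exists_max_image _ v hne
    exact ⟨v i, hv i, Or.inr (by simpa using hi), fun k hk => hmax k (by simpa using hk)⟩
  · refine ⟨0, le_rfl, Or.inl rfl, fun i hi => absurd ⟨i, ?_⟩ hne⟩
    simpa using hi

theorem utility_of_sold {n m : ℕ} {v : Fin n → ℝ} {hv : ∀ i, 0 ≤ v i} {L : Fin n → Fin m → Bool}
    (p : Fin m → ℝ) {a : Fin n → Fin m → Bool} {i : Fin n} {j : Fin m}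
    (hunit : ∀ j', a i j' = true → j' = j) (h : a i j = true) :
    (homogeneous v hv L).utility p a i = v i - p j := by
  unfold Network.utility
  rw [Finset.sum_eq_single j, if_pos h]
  · rfl
  · intro j' _ hj'
    rw [if_neg fun h' => hj' (hunit j' h')]
  · simp

theorem utility_of_unsold {n m : ℕ} {N : Network n m}
    (p : Fin m → ℝ) {a : Fin n → Fin m → Bool} {i : Fin n} (h : ∀ j, a i j = false) :
    N.utility p a i = 0 := by
  simp [Network.utility, h]

/-- Critical prices dominate all competitive prices. -/
theorem competitive_le_critical {n m : ℕ} {v : Fin n → ℝ} {hv : ∀ i, 0 ≤ v i}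
    {L : Fin n → Fin m → Bool} {p q : Fin m → ℝ} (hp : ∀ j, IsCritical v L j (p j))
    (hq : q ∈ (homogeneous v hv L).competitivePrices) : q ≤ p := by
  classical
  obtain ⟨a, ha⟩ := hq
  intro j
  by_contra hlt
  have hx : 0 < q j := (hp j).nonneg.trans_lt (not_le.mp hlt)
  apply hlt
  rw [(hp j).le_iff hx, essential_iff_exists]
  -- With `T` the goods costing at least `q j` and `A` the buyers of `U` linked only to such goods,
  -- the cover given by `A` is minimum: buyers in `U \ A` have positive utility and so are served,
  -- and every good of `T` is sold to a buyer in `A`. Thus the served buyers of `U` are at least as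
  -- many as the cover.
  set U := levelSet v (q j) with hU
  set T : Finset (Fin m) := Finset.univ.filter fun k => q j ≤ q k with hT
  have hsold : ∀ k ∈ T, ∃ i, a i k = true := by
    intro k hk
    by_contra hno
    push Not at hno
    have := ha.unsold_free k fun i => by simpa using hno i
    have := (Finset.mem_filter.mp hk).2
    linarith
  set A := U.filter fun i => ∀ k, L i k = true → k ∈ T with hA
  have hutil : ∀ i k, a i k = true → (homogeneous v hv L).utility q a i = v i - q k :=
    fun i k hik => utility_of_sold q (fun j' h => ha.buyer_unit i j' k h hik) hik
  have hmem : ∀ i, ∀ k ∈ T, a i k = true → i ∈ A := by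
    intro i k hk hik
    have hqk := (Finset.mem_filter.mp hk).2
    have h0 := ha.utility_nonneg i
    rw [hutil i k hik] at h0
    refine Finset.mem_filter.mpr ⟨mem_levelSet.mpr (by linarith), fun k' hk' => ?_⟩
    have h1 : v i - q k' ≤ _ := ha.preferred i k' hk'
    rw [hutil i k hik] at h1
    exact Finset.mem_filter.mpr ⟨Finset.mem_univ _, by linarith⟩
  have hN : neighbors L Finset.univ A ⊆ T := by
    intro k hk
    obtain ⟨-, i, hi, hl⟩ := mem_neighbors.mp hk
    exact (Finset.mem_filter.mp hi).2 k hl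
  refine ⟨A, le_antisymm ?_ (matchRank_le _ _ _ _), ?_⟩
  · set I := U.filter fun i => ∃ k, a i k = true with hI
    have hIcov : ∀ B, I.card ≤ coverCard L U Finset.univ B := by
      refine card_le_coverCard (fun i => if h : ∃ k, a i k = true then h.choose else j)
        (Finset.filter_subset _ _) ?_ ?_
      · intro i hi
        have h := (Finset.mem_filter.mp hi).2
        refine ⟨Finset.mem_univ _, ?_⟩
        rw [dif_pos h]
        exact ha.respects_links _ _ h.choose_spec
      · intro i hi i' hi' heq
        have h := (Finset.mem_filter.mp hi).2
        have h' := (Finset.mem_filter.mp hi').2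
        simp only [dif_pos h, dif_pos h'] at heq
        exact ha.seller_unit h.choose _ _ h.choose_spec (heq ▸ h'.choose_spec)
    obtain ⟨B, hB⟩ := exists_coverCard_eq L U Finset.univ
    rw [← hB]
    refine le_trans ?_ (hIcov B)
    rw [← Finset.card_sdiff_add_card_inter I A]
    refine add_le_add (Finset.card_le_card fun i hi => ?_)
      ((Finset.card_le_card hN).trans ?_)
    · obtain ⟨hiU, hiA⟩ := Finset.mem_sdiff.mp hi
      refine Finset.mem_sdiff.mpr ⟨Finset.mem_filter.mpr ⟨hiU, ?_⟩, hiA⟩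
      by_contra hno
      push Not at hno
      refine hiA (Finset.mem_filter.mpr ⟨hiU, fun k hk => ?_⟩)
      have h1 : v i - q k ≤ _ := ha.preferred i k hk
      rw [utility_of_unsold q fun k => by simpa using hno k] at h1
      have := mem_levelSet.mp hiU
      exact Finset.mem_filter.mpr ⟨Finset.mem_univ _, by linarith⟩
    · refine Finset.card_le_card_of_injOn
        (fun k => if h : ∃ i, a i k = true then h.choose else (hsold j (by simp [hT])).choose)
        (fun k hk => ?_) (fun k hk k' hk' heq => ?_)
      · have h := hsold k hk
        simp only [dif_pos h]
        have hAk := hmem _ k hk h.choose_spec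
        exact Finset.mem_inter.mpr ⟨Finset.mem_filter.mpr
          ⟨(Finset.mem_filter.mp hAk).1, k, h.choose_spec⟩, hAk⟩
      · have h := hsold k hk
        have h' := hsold k' hk'
        simp only [dif_pos h, dif_pos h'] at heq
        exact ha.buyer_unit h.choose _ _ h.choose_spec (heq ▸ h'.choose_spec)
  · have hj : j ∈ T := by simp [hT]
    obtain ⟨i, hi⟩ := hsold j hj
    exact mem_neighbors.mpr ⟨Finset.mem_univ _, i, hmem i j hj hi, ha.respects_links i j hi⟩

/-- A matching of a set of full rank saturates every minimum vertex cover. -/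
theorem matching_saturates_cover {β σ : Type*} [DecidableEq β] [DecidableEq σ]
    {L : β → σ → Bool} {I U A : Finset β} {T : Finset σ} (f : I → σ)
    (hf : Function.Injective f) (hfL : ∀ i, f i ∈ T ∧ L i (f i) = true)
    (hcard : (I ∩ U).card = coverCard L U T A) :
    U \ A ⊆ I ∧ ∀ j ∈ neighbors L T A, ∃ i : I, i.1 ∈ U ∧ i.1 ∈ A ∧ f i = j := by
  set K : Finset I := Finset.univ.filter fun i => i.1 ∈ U ∧ i.1 ∈ A with hK
  have hKcard : K.card = (I ∩ U ∩ A).card := by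
    rw [← Finset.card_map (Function.Embedding.subtype _)]
    congr 1
    ext i
    simp only [hK, Finset.mem_map, Finset.mem_filter, Finset.mem_univ, true_and,
      Function.Embedding.coe_subtype, Subtype.exists, Finset.mem_inter]
    constructor
    · rintro ⟨k, hk, h, rfl⟩
      exact ⟨⟨hk, h.1⟩, h.2⟩
    · rintro ⟨⟨hk, h⟩, h'⟩
      exact ⟨i, hk, ⟨h, h'⟩, rfl⟩
  have hKsub : K.image f ⊆ neighbors L T A := by
    intro j hj
    obtain ⟨i, hi, rfl⟩ := Finset.mem_image.mp hj
    exact mem_neighbors.mpr ⟨(hfL i).1, i, (Finset.mem_filter.mp hi).2.2, (hfL i).2⟩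
  have hKimg : (K.image f).card = K.card := Finset.card_image_of_injective _ hf
  have hsub : (I ∩ U) \ A ⊆ U \ A := Finset.sdiff_subset_sdiff Finset.inter_subset_right le_rfl
  have h1 := Finset.card_sdiff_add_card_inter (I ∩ U) A
  have h2 := Finset.card_le_card hKsub
  have h3 := Finset.card_le_card hsub
  simp only [coverCard] at hcard
  -- The matched buyers outside `A` and the goods of those inside `A` fit in the two halves of the
  -- cover; the equality of total sizes forces equality in both halves.
  have e1 := Finset.eq_of_subset_of_card_le hKsub (by omega)
  have e2 := Finset.eq_of_subset_of_card_le hsub (by omega)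
  refine ⟨fun i hi => ?_, fun j hj => ?_⟩
  · rw [← e2] at hi
    exact (Finset.mem_inter.mp (Finset.mem_sdiff.mp hi).1).1
  · rw [← e1] at hj
    obtain ⟨i, hi, rfl⟩ := Finset.mem_image.mp hj
    have := (Finset.mem_filter.mp hi).2
    exact ⟨i, this.1, this.2, rfl⟩

/-- Critical prices are competitive. -/
theorem critical_mem_competitivePrices {n m : ℕ} {v : Fin n → ℝ} {hv : ∀ i, 0 ≤ v i}
    {L : Fin n → Fin m → Bool} {p : Fin m → ℝ} (hp : ∀ j, IsCritical v L j (p j)) :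
    p ∈ (homogeneous v hv L).competitivePrices := by
  classical
  obtain ⟨I, -, hI, hlev⟩ := exists_simultaneous_basis L Finset.univ v Finset.univ
  obtain ⟨f, hf, hfL⟩ := exists_matching_of_matchRank_eq hI
  have hlev' : ∀ x, (I ∩ levelSet v x).card = matchRank L (levelSet v x) Finset.univ := by
    intro x
    have e1 : I ∩ levelSet v x = I.filter (x ≤ v ·) := by
      ext i
      simp [mem_levelSet]
    have e2 : levelSet v x = Finset.univ.filter (x ≤ v ·) := by
      ext i
      simp [mem_levelSet]
    rw [e1, hlev x, e2]
  have hsat : ∀ x A, coverCard L (levelSet v x) Finset.univ A =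
      matchRank L (levelSet v x) Finset.univ → _ := fun x A hA =>
    matching_saturates_cover f hf hfL ((hlev' x).trans hA.symm)
  -- an essential seller is sold to a buyer of the level set, whose neighbors are all essential
  have hess : ∀ x j, Essential L (levelSet v x) Finset.univ j → ∃ i : I, f i = j ∧ x ≤ v i ∧
      ∀ k, L i k = true → Essential L (levelSet v x) Finset.univ k := by
    intro x j hj
    obtain ⟨A, hA, hjA⟩ := essential_iff_exists.mp hj
    obtain ⟨i, hiU, hiA, hij⟩ := (hsat x A hA).2 j hjA
    exact ⟨i, hij, mem_levelSet.mp hiU, fun k hk => essential_iff_exists.mpr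
      ⟨A, hA, mem_neighbors.mpr ⟨Finset.mem_univ _, i, hiA, hk⟩⟩⟩
  -- An unmatched buyer lies in `A` for every minimum cover at her own level, so each good linked to
  -- her costs at least her value when that value is positive.
  have hfree : ∀ i ∉ I, ∀ k, L i k = true →
      Essential L (levelSet v (v i)) Finset.univ k := by
    intro i hi k hk
    obtain ⟨A, hA⟩ := exists_coverCard_eq L (levelSet v (v i)) Finset.univ
    have hiA : i ∈ A := by
      by_contra hiA
      exact hi ((hsat _ A hA).1 (Finset.mem_sdiff.mpr ⟨mem_levelSet.mpr le_rfl, hiA⟩))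
    exact essential_iff_exists.mpr ⟨A, hA, mem_neighbors.mpr ⟨Finset.mem_univ _, i, hiA, hk⟩⟩
  have hpos : ∀ j, 0 < p j → ∃ i : I, f i = j ∧ p j ≤ v i ∧
      ∀ k, L i k = true → p j ≤ p k := by
    intro j hj
    obtain ⟨i, hij, hi, hk⟩ := hess _ j (((hp j).le_iff hj).mp le_rfl)
    exact ⟨i, hij, hi, fun k hl => ((hp k).le_iff hj).mpr (hk k hl)⟩
  have hbuy : ∀ i : I, p (f i) ≤ v i ∧ ∀ k, L i k = true → p (f i) ≤ p k := by
    intro i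
    rcases (hp (f i)).nonneg.eq_or_lt with h0 | h0
    · rw [← h0]
      exact ⟨hv _, fun k _ => (hp k).nonneg⟩
    · obtain ⟨i', hi', h⟩ := hpos _ h0
      rwa [hf hi'] at h
  set a : Fin n → Fin m → Bool := fun i j => decide (∃ h : i ∈ I, f ⟨i, h⟩ = j) with ha
  have hamem : ∀ i j, a i j = true ↔ ∃ h : i ∈ I, f ⟨i, h⟩ = j := by simp [ha]
  have hunit : ∀ i j j', a i j = true → a i j' = true → j = j' := by
    intro i j j' h h'
    obtain ⟨h, rfl⟩ := (hamem _ _).mp h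
    obtain ⟨h', rfl⟩ := (hamem _ _).mp h'
    rfl
  have hmatched : ∀ i : I, (homogeneous v hv L).utility p a i = v i - p (f i) := fun i =>
    utility_of_sold p (fun j' h => hunit i _ _ h ((hamem _ _).mpr ⟨i.2, rfl⟩))
      ((hamem _ _).mpr ⟨i.2, rfl⟩)
  have hunmatched : ∀ i ∉ I, (homogeneous v hv L).utility p a i = 0 := by
    intro i hi
    refine utility_of_unsold p fun j => ?_
    rw [Bool.eq_false_iff]
    exact fun h => hi ((hamem _ _).mp h).1
  refine ⟨a, fun j => (hp j).nonneg, ?_, hunit, ?_, ?_, ?_, ?_⟩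
  · intro i j h
    obtain ⟨hi, rfl⟩ := (hamem _ _).mp h
    exact (hfL ⟨i, hi⟩).2
  · intro j i i' h h'
    obtain ⟨h, rfl⟩ := (hamem _ _).mp h
    obtain ⟨h', he⟩ := (hamem _ _).mp h'
    exact (congrArg Subtype.val (hf he)).symm
  · intro i k hk
    change v i - p k ≤ _
    by_cases hi : i ∈ I
    · rw [hmatched ⟨i, hi⟩]
      have := (hbuy ⟨i, hi⟩).2 k hk
      linarith
    · rw [hunmatched i hi]
      rcases (hv i).eq_or_lt with h0 | h0
      · have := (hp k).nonneg
        linarith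
      · have := ((hp k).le_iff h0).mpr (hfree i hi k hk)
        linarith
  · intro i
    by_cases hi : i ∈ I
    · rw [hmatched ⟨i, hi⟩]
      have := (hbuy ⟨i, hi⟩).1
      simp only at this
      linarith
    · rw [hunmatched i hi]
  · intro j hj
    by_contra hne
    obtain ⟨i, hij, -⟩ := hpos j ((hp j).nonneg.lt_of_ne' hne)
    have := (hamem i j).mpr ⟨i.2, hij⟩
    rw [hj] at this
    exact absurd this (by simp)

theorem isGreatest_critical {n m : ℕ} {v : Fin n → ℝ} {hv : ∀ i, 0 ≤ v i}
    {L : Fin n → Fin m → Bool} {p : Fin m → ℝ} (hp : ∀ j, IsCritical v L j (p j)) :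
    IsGreatest (homogeneous v hv L).competitivePrices p :=
  ⟨critical_mem_competitivePrices hp, fun _ hq => competitive_le_critical hp hq⟩

theorem maxPrice_eq_of_isGreatest {n m : ℕ} {N : Network n m} {p : Fin m → ℝ}
    (hp : IsGreatest N.competitivePrices p) : N.maxPrice = p := by
  funext j
  have : IsGreatest {x | ∃ q ∈ N.competitivePrices, x = q j} (p j) :=
    ⟨⟨p, hp.1, rfl⟩, by rintro _ ⟨q, hq, rfl⟩; exact hp.2 hq j⟩
  exact this.csSup_eq

theorem isCritical_maxPrice {n m : ℕ} {v : Fin n → ℝ} (hv : ∀ i, 0 ≤ v i)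
    (L : Fin n → Fin m → Bool) (j : Fin m) :
    IsCritical v L j ((homogeneous v hv L).maxPrice j) := by
  choose p hp using exists_isCritical hv L
  rw [maxPrice_eq_of_isGreatest (isGreatest_critical (hv := hv) hp)]
  exact hp j

theorem isGreatest_maxPrice {n m : ℕ} {v : Fin n → ℝ} (hv : ∀ i, 0 ≤ v i)
    (L : Fin n → Fin m → Bool) :
    IsGreatest (homogeneous v hv L).competitivePrices (homogeneous v hv L).maxPrice :=
  isGreatest_critical fun j => isCritical_maxPrice hv L j

theorem IsCritical.unique {n m : ℕ} {v : Fin n → ℝ} {L : Fin n → Fin m → Bool} {j : Fin m}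
    {r r' : ℝ} (h : IsCritical v L j r) (h' : IsCritical v L j r') : r = r' := by
  refine le_antisymm ?_ ?_
  · rcases h.nonneg.eq_or_lt with h0 | h0
    · exact h0 ▸ h'.nonneg
    · exact (h'.le_iff h0).mpr ((h.le_iff h0).mp le_rfl)
  · rcases h'.nonneg.eq_or_lt with h0 | h0
    · exact h0 ▸ h.nonneg
    · exact (h.le_iff h0).mpr ((h'.le_iff h0).mp le_rfl)

/-! ## Platform prices and the greedy algorithm -/

/-- The graph `g` with every seller of `P` linked to all buyers. -/
def joinLink {n m : ℕ} (g : Fin n → Fin m → Bool) (P : Finset (Fin m)) : Fin n → Fin m → Bool :=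
  fun i j => decide (j ∈ P) || g i j

theorem joinLink_eq_true {n m : ℕ} {g : Fin n → Fin m → Bool} {P : Finset (Fin m)} {i : Fin n}
    {j : Fin m} : joinLink g P i j = true ↔ j ∈ P ∨ g i j = true := by
  simp [joinLink]

/-- A platform seller neighbors every nonempty `A`. So a cover either has `A = ∅` and size `U.card`,
or it pays for all of `P ∩ T` and is otherwise a cover off the platform. -/
theorem matchRank_joinLink {n m : ℕ} (g : Fin n → Fin m → Bool) (P : Finset (Fin m))
    (U : Finset (Fin n)) (T : Finset (Fin m)) :
    matchRank (joinLink g P) U T = min U.card ((P ∩ T).card + matchRank g U (T \ P)) := by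
  apply le_antisymm
  · refine le_min (matchRank_le_card _ _ _) ?_
    obtain ⟨A, hA⟩ := exists_coverCard_eq g U (T \ P)
    have h1 := matchRank_le (joinLink g P) U T A
    have h2 : neighbors (joinLink g P) T A ⊆ (P ∩ T) ∪ neighbors g (T \ P) A := by
      intro t ht
      obtain ⟨htT, a, ha, hl⟩ := mem_neighbors.mp ht
      rw [joinLink_eq_true] at hl
      by_cases htP : t ∈ P
      · exact Finset.mem_union_left _ (Finset.mem_inter.mpr ⟨htP, htT⟩)
      · exact Finset.mem_union_right _ (mem_neighbors.mpr
          ⟨Finset.mem_sdiff.mpr ⟨htT, htP⟩, a, ha, hl.resolve_left htP⟩)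
    have h3 := (Finset.card_le_card h2).trans (Finset.card_union_le _ _)
    simp only [coverCard] at *
    omega
  · obtain ⟨A, hA⟩ := exists_coverCard_eq (joinLink g P) U T
    rcases A.eq_empty_or_nonempty with rfl | ⟨b, hb⟩
    · have : coverCard (joinLink g P) U T ∅ = U.card := by simp [coverCard, neighbors]
      exact (min_le_left _ _).trans (by omega)
    · refine (min_le_right _ _).trans ?_
      have h1 := matchRank_le g U (T \ P) A
      have h2 : (P ∩ T) ∪ neighbors g (T \ P) A ⊆ neighbors (joinLink g P) T A := by
        intro t ht
        rcases Finset.mem_union.mp ht with h | h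
        · exact mem_neighbors.mpr ⟨(Finset.mem_inter.mp h).2, b, hb,
            joinLink_eq_true.mpr (Or.inl (Finset.mem_inter.mp h).1)⟩
        · obtain ⟨htT, a, ha, hl⟩ := mem_neighbors.mp h
          exact mem_neighbors.mpr ⟨(Finset.mem_sdiff.mp htT).1, a, ha,
            joinLink_eq_true.mpr (Or.inr hl)⟩
      have h3 : Disjoint (P ∩ T) (neighbors g (T \ P) A) := by
        rw [Finset.disjoint_left]
        intro t ht ht'
        exact (Finset.mem_sdiff.mp (mem_neighbors.mp ht').1).2 (Finset.mem_inter.mp ht).1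
      have h4 := Finset.card_le_card h2
      rw [Finset.card_union_of_disjoint h3] at h4
      simp only [coverCard] at *
      omega

theorem le_of_forall_pos_le {a b : ℝ} (hb : 0 ≤ b) (h : ∀ x, 0 < x → x ≤ a → x ≤ b) :
    a ≤ b := by
  rcases le_or_gt a 0 with ha | ha
  · exact ha.trans hb
  · exact h a ha le_rfl

section Greedy

variable {n m : ℕ} {v : Fin n → ℝ} (hv : ∀ i, 0 ≤ v i) (g : Fin n → Fin m → Bool) {α : ℝ}

/-- The number of buyers of value at least `x` that can be matched outside the platform. -/
noncomputable def offRank (v : Fin n → ℝ) (g : Fin n → Fin m → Bool) (x : ℝ)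
    (P : Finset (Fin m)) : ℕ :=
  matchRank g (levelSet v x) (Finset.univ \ P)

/-- The platform price is at least `x`. -/
def PlatformTight (v : Fin n → ℝ) (g : Fin n → Fin m → Bool) (x : ℝ) (P : Finset (Fin m)) : Prop :=
  P.card + offRank v g x P ≤ (levelSet v x).card

theorem isCritical_price (P : Finset (Fin m)) (j : Fin m) :
    IsCritical v (joinLink g P) j ((homogeneous v hv g).price P j) :=
  isCritical_maxPrice hv (joinLink g P) j

theorem isGreatest_price (P : Finset (Fin m)) :
    IsGreatest ((homogeneous v hv g).join P).competitivePrices ((homogeneous v hv g).price P) :=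
  isGreatest_maxPrice hv (joinLink g P)

theorem price_nonneg (P : Finset (Fin m)) (j : Fin m) : 0 ≤ (homogeneous v hv g).price P j :=
  (isCritical_price hv g P j).nonneg

/-- Deleting `j` lowers the second argument of the minimum in `matchRank_joinLink` by exactly one,
which shows iff that argument is at most the first. The condition does not involve `j`, so members
share one price. -/
theorem le_price_iff_of_mem {P : Finset (Fin m)} {j : Fin m} (hj : j ∈ P) {x : ℝ} (hx : 0 < x) :
    x ≤ (homogeneous v hv g).price P j ↔ PlatformTight v g x P := by
  rw [(isCritical_price hv g P j).le_iff hx]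
  have e1 : (Finset.univ.erase j) \ P = Finset.univ \ P := by
    ext k
    simp only [Finset.mem_sdiff, Finset.mem_erase, Finset.mem_univ, and_true, true_and]
    exact ⟨fun h => h.2, fun h => ⟨fun hk => h (hk ▸ hj), h⟩⟩
  have e2 : P ∩ Finset.univ.erase j = P.erase j := by
    rw [Finset.inter_erase, Finset.inter_univ]
  have := Finset.card_erase_add_one hj
  unfold Essential PlatformTight offRank
  rw [matchRank_joinLink, matchRank_joinLink, e1, e2, Finset.inter_univ]
  omega

theorem sdiff_insert_eq_erase (P : Finset (Fin m)) (j : Fin m) :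
    Finset.univ \ insert j P = (Finset.univ \ P).erase j := by
  ext k
  simp only [Finset.mem_sdiff, Finset.mem_erase, Finset.mem_univ, true_and, Finset.mem_insert]
  tauto

theorem essential_iff_offRank {P : Finset (Fin m)} {j : Fin m} {x : ℝ} :
    Essential g (levelSet v x) (Finset.univ \ P) j ↔
      offRank v g x (insert j P) < offRank v g x P := by
  unfold Essential offRank
  rw [sdiff_insert_eq_erase]

theorem offRank_insert_le (P : Finset (Fin m)) (j : Fin m) (x : ℝ) :
    offRank v g x (insert j P) ≤ offRank v g x P ∧
      offRank v g x P ≤ offRank v g x (insert j P) + 1 := by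
  unfold offRank
  rw [sdiff_insert_eq_erase]
  exact ⟨matchRank_mono le_rfl (Finset.erase_subset _ _), matchRank_le_erase_seller _ _ _ _⟩

theorem offRank_anti {P Q : Finset (Fin m)} (h : P ⊆ Q) (x : ℝ) :
    offRank v g x Q ≤ offRank v g x P :=
  matchRank_mono le_rfl (Finset.sdiff_subset_sdiff le_rfl h)

theorem le_price_iff_of_notMem {P : Finset (Fin m)} {j : Fin m} (hj : j ∉ P) {x : ℝ}
    (hx : 0 < x) :
    x ≤ (homogeneous v hv g).price P j ↔
      PlatformTight v g x P ∧ offRank v g x (insert j P) < offRank v g x P := by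
  rw [(isCritical_price hv g P j).le_iff hx]
  have e1 : (Finset.univ.erase j) \ P = (Finset.univ \ P).erase j := Finset.erase_sdiff_comm _ _ _
  have e2 : P ∩ Finset.univ.erase j = P := by
    rw [Finset.inter_erase, Finset.inter_univ, Finset.erase_eq_of_notMem hj]
  have := offRank_insert_le (v := v) g P j x
  unfold Essential PlatformTight
  rw [matchRank_joinLink, matchRank_joinLink, e1, e2, Finset.inter_univ, ← sdiff_insert_eq_erase]
  change _ < min _ (_ + offRank v g x P) ↔ _
  change min _ (_ + offRank v g x (insert j P)) < _ ↔ _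
  omega

theorem offPrice_of_notMem {N : Network n m} {P : Finset (Fin m)} {j : Fin m} (hj : j ∉ P) :
    N.offPrice P j = N.price P j := by
  rw [Network.offPrice, Finset.erase_eq_of_notMem hj]

theorem le_onPrice_iff (P : Finset (Fin m)) (j : Fin m) {x : ℝ} (hx : 0 < x) :
    x ≤ (homogeneous v hv g).onPrice P j ↔ PlatformTight v g x (insert j P) :=
  le_price_iff_of_mem hv g (Finset.mem_insert_self j P) hx

/-- Splits the on-platform price of `j` into a part independent of `j` and her present price;
comparing the gains of two outsiders rests on this. -/
theorem platformTight_insert_iff {P : Finset (Fin m)} {j : Fin m} (hj : j ∉ P) {x : ℝ} :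
    PlatformTight v g x (insert j P) ↔ P.card + 1 + offRank v g x P ≤ (levelSet v x).card ∨
      (PlatformTight v g x P ∧ offRank v g x (insert j P) < offRank v g x P) := by
  have := offRank_insert_le (v := v) g P j x
  unfold PlatformTight
  rw [Finset.card_insert_of_notMem hj]
  omega

theorem price_le_onPrice {P : Finset (Fin m)} {j : Fin m} (hj : j ∉ P) :
    (homogeneous v hv g).price P j ≤ (homogeneous v hv g).onPrice P j :=
  le_of_forall_pos_le (price_nonneg hv g _ _) fun x hx h => by
    rw [le_onPrice_iff hv g P j hx, platformTight_insert_iff g hj]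
    exact Or.inr ((le_price_iff_of_notMem hv g hj hx).mp h)

theorem onPrice_le_max {P : Finset (Fin m)} {j k : Fin m} (hj : j ∉ P) (hk : k ∉ P) :
    (homogeneous v hv g).onPrice P k ≤
      max ((homogeneous v hv g).onPrice P j) ((homogeneous v hv g).price P k) := by
  refine le_of_forall_pos_le (le_max_of_le_right (price_nonneg hv g _ _)) fun x hx h => ?_
  rw [le_onPrice_iff hv g P k hx, platformTight_insert_iff g hk] at h
  rw [le_max_iff, le_onPrice_iff hv g P j hx, platformTight_insert_iff g hj,
    le_price_iff_of_notMem hv g hk hx]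
  tauto

/-- The gain is antitone in the off-platform price. -/
theorem gain_le_gain (hα : 0 ≤ α) (hα1 : α ≤ 1) {P : Finset (Fin m)} {j k : Fin m} (hj : j ∉ P)
    (hk : k ∉ P)
    (h : (homogeneous v hv g).price P j ≤ (homogeneous v hv g).price P k) :
    (homogeneous v hv g).gain α P k ≤ (homogeneous v hv g).gain α P j := by
  have h1 := onPrice_le_max hv g hj hk
  have h2 := price_le_onPrice hv g hj
  unfold Network.gain
  rw [offPrice_of_notMem hj, offPrice_of_notMem hk]
  rcases le_max_iff.mp h1 with h1 | h1 <;> nlinarith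

/-- An outsider of lowest price maximizes the gain by `gain_le_gain`, and the tie-breaking rule then
admits only sellers of that price. Without the rule, a seller of higher price with an equal gain
could be chosen. -/
theorem isSelected_iff (hα : 0 ≤ α) (hα1 : α ≤ 1) {P : Finset (Fin m)} {j : Fin m} :
    (homogeneous v hv g).IsSelected α P j ↔ j ∉ P ∧ ∀ k ∉ P,
      (homogeneous v hv g).price P j ≤ (homogeneous v hv g).price P k := by
  classical
  constructor
  · rintro ⟨⟨hj, hmax⟩, hmin⟩
    refine ⟨hj, fun k hk => ?_⟩
    obtain ⟨l, hl, hlmin⟩ := Finset.exists_min_image (Finset.univ \ P)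
      ((homogeneous v hv g).price P) ⟨j, by simpa using hj⟩
    have hl : l ∉ P := by simpa using hl
    have h1 := gain_le_gain hv g hα hα1 hl hj (hlmin j (by simpa using hj))
    have h2 := hmin l ⟨hl, fun k hk => (hmax k hk).trans h1⟩
    rw [offPrice_of_notMem hj, offPrice_of_notMem hl] at h2
    exact h2.trans (hlmin k (by simpa using hk))
  · rintro ⟨hj, hmin⟩
    refine ⟨⟨hj, fun k hk => gain_le_gain hv g hα hα1 hj hk (hmin k hk)⟩, fun k hk => ?_⟩
    rw [offPrice_of_notMem hj, offPrice_of_notMem hk.1]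
    exact hmin k hk.1

theorem exists_isSelected (hα : 0 ≤ α) (hα1 : α ≤ 1) {P : Finset (Fin m)}
    (hP : P ≠ Finset.univ) : ∃ j, (homogeneous v hv g).IsSelected α P j := by
  have hne : (Finset.univ \ P).Nonempty := by
    rw [Finset.sdiff_nonempty]
    exact fun h => hP (Finset.univ_subset_iff.mp h)
  obtain ⟨l, hl, hlmin⟩ := Finset.exists_min_image _ ((homogeneous v hv g).price P) hne
  exact ⟨l, (isSelected_iff hv g hα hα1).mpr
    ⟨by simpa using hl, fun k hk => hlmin k (by simpa using hk)⟩⟩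

theorem exists_greedy_completion (hα : 0 ≤ α) (hα1 : α ≤ 1) (P : Finset (Fin m)) :
    Relation.ReflTransGen ((homogeneous v hv g).GreedyStep α) ∅ P →
      ∃ P', Relation.ReflTransGen ((homogeneous v hv g).GreedyStep α) P P' ∧
        (homogeneous v hv g).IsGreedyOutput α P' := by
  induction h : m - P.card using Nat.strong_induction_on generalizing P with
  | _ k ih =>
    intro hP
    by_cases huniv : P = Finset.univ
    · exact ⟨P, .refl, hP, Or.inl huniv⟩
    · obtain ⟨j, hj⟩ := exists_isSelected hv g hα hα1 huniv
      by_cases hgain : 0 ≤ (homogeneous v hv g).gain α P j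
      · have hstep : (homogeneous v hv g).GreedyStep α P (insert j P) := ⟨j, hj, hgain, rfl⟩
        have hjP : j ∉ P := hj.1.1
        have hcard := Finset.card_le_univ (insert j P)
        rw [Finset.card_insert_of_notMem hjP, Fintype.card_fin] at hcard
        obtain ⟨P', h1, h2⟩ := ih (m - (insert j P).card)
          (by rw [Finset.card_insert_of_notMem hjP]; omega) _ rfl (hP.tail hstep)
        exact ⟨P', .head hstep h1, h2⟩
      · exact ⟨P, .refl, hP, Or.inr ⟨j, hj, not_le.mp hgain⟩⟩

/-- Either the platform price is `0`, or all sellers who joined had at most the price `y` off the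
platform, all other sellers have at least the price `y`, and `y` is small compared to the platform
price. -/
def GreedyInvariant (α : ℝ) (P : Finset (Fin m)) : Prop :=
  (∀ x, 0 < x → ¬ PlatformTight v g x P) ∨
  ∃ y, 0 ≤ y ∧ (∀ x, y < x → offRank v g x ∅ = offRank v g x P) ∧
    (∀ k ∉ P, ∀ x, 0 < x → x ≤ y → Essential g (levelSet v x) (Finset.univ \ P) k) ∧
    ∀ j ∈ P, y ≤ (1 - α) * (homogeneous v hv g).price P j

theorem greedyInvariant_empty : GreedyInvariant hv g α ∅ :=
  Or.inr ⟨0, le_rfl, fun _ _ => rfl, fun _ _ x hx hx' => absurd hx' (not_le.mpr hx), by simp⟩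

/-- The new `y` is the off-platform price `c` of the joining seller. Positivity of `α` makes `c`
strictly smaller than a positive on-platform price `r`, which leaves room to compare levels just
above `c`. -/
theorem GreedyInvariant.step (hα : 0 < α) (hα1 : α ≤ 1) {P P' : Finset (Fin m)}
    (hP : GreedyInvariant hv g α P) (hstep : (homogeneous v hv g).GreedyStep α P P') :
    GreedyInvariant hv g α P' := by
  obtain ⟨j, hsel, hgain, rfl⟩ := hstep
  obtain ⟨hj, hmin⟩ := (isSelected_iff hv g hα.le hα1).mp hsel
  unfold Network.gain at hgain
  rw [offPrice_of_notMem hj] at hgain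
  set c := (homogeneous v hv g).price P j with hc
  set r := (homogeneous v hv g).onPrice P j with hr
  have hr_iff : ∀ x, 0 < x → (x ≤ r ↔ PlatformTight v g x (insert j P)) :=
    fun x hx => le_onPrice_iff hv g P j hx
  have hc0 : 0 ≤ c := price_nonneg hv g P j
  have hr0 : 0 ≤ r := price_nonneg hv g (insert j P) j
  rcases hr0.eq_or_lt with hr0 | hr0
  · exact Or.inl fun x hx ht => by
      have := (hr_iff x hx).mpr ht
      linarith
  have htight : ∀ x, 0 < x → x ≤ r → PlatformTight v g x P := by
    intro x hx hxr
    rcases (platformTight_insert_iff g hj).mp ((hr_iff x hx).mp hxr) with h | h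
    · unfold PlatformTight
      omega
    · exact h.1
  have hcr : c < r := by nlinarith
  obtain ⟨y, hy0, hyrank, hyess, hyprice⟩ : ∃ y, _ :=
    hP.resolve_left fun h => h r hr0 (htight r hr0 le_rfl)
  -- Off-platform prices of successive joiners do not decrease: up to `y` every outsider is
  -- essential, and the platform is tight there since `y` is at most the platform price.
  have hyc : y ≤ c := by
    refine le_of_forall_pos_le hc0 fun x hx hxy => ?_
    rw [le_price_iff_of_notMem hv g hj hx, ← essential_iff_offRank]
    refine ⟨?_, hyess j hj x hx hxy⟩
    rcases P.eq_empty_or_nonempty with rfl | ⟨k, hk⟩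
    · simpa [PlatformTight, offRank] using matchRank_le_card g (levelSet v x) Finset.univ
    · rw [← le_price_iff_of_mem hv g hk hx]
      have := hyprice k hk
      have := price_nonneg hv g P k
      nlinarith
  -- If `j` were essential at some `x > c`, she would be so at `min x r`, where the platform is
  -- still tight; her price would then exceed `c`.
  have hrank : ∀ x, c < x → offRank v g x (insert j P) = offRank v g x P := by
    intro x hx
    have h1 := (offRank_insert_le (v := v) g P j x).1
    by_contra hne
    have hess := (essential_iff_offRank g).mpr (h1.lt_of_ne hne)
    have hmin : Essential g (levelSet v (min x r)) (Finset.univ \ P) j :=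
      hess.mono (levelSet_anti v (min_le_left _ _)) le_rfl (by simpa using hj)
    have hlt : c < min x r := lt_min hx hcr
    have := (le_price_iff_of_notMem hv g hj (hc0.trans_lt hlt)).mpr
      ⟨htight _ (hc0.trans_lt hlt) (min_le_right _ _), (essential_iff_offRank g).mp hmin⟩
    exact absurd this (not_le.mpr hlt)
  refine Or.inr ⟨c, hc0, fun x hx => ?_, fun k hk x hx hxc => ?_, fun k hk => ?_⟩
  · rw [hrank x hx, hyrank x (hyc.trans_lt hx)]
  · have hkP : k ∉ P := fun h => hk (Finset.mem_insert_of_mem h)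
    have h1 := (le_price_iff_of_notMem hv g hkP hx).mp (hxc.trans (hmin k hkP))
    exact ((essential_iff_offRank g).mpr h1.2).mono le_rfl
      (Finset.sdiff_subset_sdiff le_rfl (Finset.subset_insert j P)) (by simpa using hk)
  · have : (homogeneous v hv g).price (insert j P) k = r := by
      refine le_antisymm (le_of_forall_pos_le hr0.le fun x hx h => ?_)
        (le_of_forall_pos_le (price_nonneg hv g _ _) fun x hx h => ?_)
      · rwa [hr_iff x hx, ← le_price_iff_of_mem hv g hk hx]
      · rwa [le_price_iff_of_mem hv g hk hx, ← hr_iff x hx]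
    rw [this]
    linarith

/-- Above `y`, removing all of `P` costs no off-platform rank, so neither does removing `j` after
the others. Hence the price of a deviating `j` cannot exceed `y`, whenever she joined. -/
theorem GreedyInvariant.price_erase_le {P : Finset (Fin m)} (hP : GreedyInvariant hv g α P)
    {j : Fin m} (hj : j ∈ P) :
    (homogeneous v hv g).price (P.erase j) j ≤ (1 - α) * (homogeneous v hv g).price P j := by
  have hjn : j ∉ P.erase j := Finset.notMem_erase j P
  rcases hP with h | ⟨y, hy0, hyrank, -, hyprice⟩
  · have h1 := price_le_onPrice hv g hjn
    rw [Network.onPrice, Finset.insert_erase hj] at h1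
    have h2 : (homogeneous v hv g).price P j = 0 := by
      refine le_antisymm (le_of_forall_pos_le le_rfl fun x hx hxp => ?_) (price_nonneg hv g _ _)
      exact absurd ((le_price_iff_of_mem hv g hj hx).mp hxp) (h x hx)
    rw [h2] at h1 ⊢
    simpa using h1
  · refine le_trans (le_of_forall_pos_le hy0 fun x hx hxp => ?_) (hyprice j hj)
    by_contra hlt
    have h1 := ((le_price_iff_of_notMem hv g hjn hx).mp hxp).2
    rw [Finset.insert_erase hj, ← hyrank x (not_le.mp hlt)] at h1
    have h2 := offRank_anti (v := v) g (Finset.empty_subset (P.erase j)) x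
    omega

theorem IsGreedyOutput.isPurePlatformEquilibrium (hα : 0 ≤ α) (hα1 : α ≤ 1)
    {P : Finset (Fin m)} (hP : (homogeneous v hv g).IsGreedyOutput α P) :
    (homogeneous v hv g).IsPurePlatformEquilibrium α P := by
  obtain ⟨hrun, hleft⟩ := hP
  refine ⟨fun j hj => ?_, fun j hj => ?_⟩
  · rcases hα.eq_or_lt with rfl | hα
    · have h1 := price_le_onPrice hv g (Finset.notMem_erase j P)
      rw [Network.onPrice, Finset.insert_erase hj] at h1
      linarith
    · refine GreedyInvariant.price_erase_le hv g ?_ hj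
      clear hleft hj
      induction hrun with
      | refl => exact greedyInvariant_empty hv g
      | tail _ hstep ih => exact ih.step hv g hα hα1 hstep
  · rcases hleft with rfl | ⟨k, hk, hgain⟩
    · exact absurd (Finset.mem_univ j) hj
    · have h1 := hk.1.2 j hj
      rw [Network.gain, offPrice_of_notMem hj] at h1
      unfold Network.onPrice at h1
      linarith

end Greedy

/-! ## Computing the rank by an auction

The buyers of `W` have come so far. Seller `k` is held by buyer `o k - 1` (by nobody if `o k = 0`) at
level `d k`, buyer `cur - 1` is about to bid, and `count` buyers have given up. -/

/-- The slack of one in `cheap` is the bid increment: a good was cheapest for its holder before her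
bid raised it. With `rejected` this is approximate complementary slackness, and the cap `m + 1` is
just large enough for a pigeonhole gap. -/
structure AuctionInvariant {n m : ℕ} (L : Fin n → Fin m → Bool) (T : Finset (Fin m))
    (W : Finset (Fin n)) (o d : Fin m → ℕ) (cur count : ℕ) : Prop where
  assigned : ∀ k, o k = 0 ∨ ∃ b ∈ W, o k = (b : ℕ) + 1 ∧ k ∈ T ∧ L b k = true
  hand : cur = 0 ∨ ∃ b ∈ W, cur = (b : ℕ) + 1 ∧ ∀ k, o k ≠ cur
  inj : ∀ k k', o k ≠ 0 → o k = o k' → k = k'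
  cheap : ∀ k, ∀ b : Fin n, o k = (b : ℕ) + 1 → ∀ k' ∈ T, L b k' = true → d k ≤ d k' + 1
  free : ∀ k, o k = 0 → d k = 0
  rejected : ∀ b ∈ W, (∀ k, o k ≠ (b : ℕ) + 1) → cur ≠ (b : ℕ) + 1 →
    ∀ k ∈ T, L b k = true → m + 1 ≤ d k
  count_eq : count + (Finset.univ.filter fun k => o k ≠ 0).card + (if cur = 0 then 0 else 1) =
    W.card
  level_le : ∀ k, d k ≤ m + 1

namespace AuctionInvariant

variable {n m : ℕ} {L : Fin n → Fin m → Bool} {T : Finset (Fin m)} {W : Finset (Fin n)}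
  {o d : Fin m → ℕ} {cur count : ℕ}

theorem start (L : Fin n → Fin m → Bool) (T : Finset (Fin m)) :
    AuctionInvariant L T ∅ (fun _ => 0) (fun _ => 0) 0 0 := by
  constructor <;> simp

theorem take (h : AuctionInvariant L T W o d 0 count) {b : Fin n} (hb : b ∉ W) :
    AuctionInvariant L T (insert b W) o d ((b : ℕ) + 1) count where
  assigned k := (h.assigned k).imp_right fun ⟨b', hb', h'⟩ =>
    ⟨b', Finset.mem_insert_of_mem hb', h'⟩
  hand := Or.inr ⟨b, Finset.mem_insert_self b W, rfl, fun k hk => by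
    rcases h.assigned k with h0 | ⟨b', hb', h1, -⟩
    · omega
    · have : b' = b := Fin.ext (by omega)
      exact hb (this ▸ hb')⟩
  inj := h.inj
  cheap := h.cheap
  free := h.free
  rejected b' hb' h1 h2 := by
    rcases Finset.mem_insert.mp hb' with rfl | hb'
    · exact absurd rfl h2
    · exact h.rejected b' hb' h1 (by omega)
  count_eq := by
    have := h.count_eq
    rw [Finset.card_insert_of_notMem hb]
    simp only [if_true, Nat.add_eq_zero_iff, one_ne_zero, and_false, if_false] at this ⊢
    omega
  level_le := h.level_le

theorem giveUp {b : Fin n} (h : AuctionInvariant L T W o d ((b : ℕ) + 1) count)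
    (hb : ∀ k ∈ T, L b k = true → m + 1 ≤ d k) : AuctionInvariant L T W o d 0 (count + 1) where
  assigned := h.assigned
  hand := Or.inl rfl
  inj := h.inj
  cheap := h.cheap
  free := h.free
  rejected b' hb' h1 _ := by
    by_cases hbb : b' = b
    · exact hbb ▸ hb
    · refine h.rejected b' hb' h1 fun he => hbb (Fin.ext (by omega))
  count_eq := by
    have := h.count_eq
    simp only [if_true, Nat.add_eq_zero_iff, one_ne_zero, and_false, if_false] at this ⊢
    omega
  level_le := h.level_le

/-- Levels only rise, so the bounds for other holders and for rejected buyers survive. The displaced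
holder, if any, becomes the bidder; if the good was free, the cell `0` ends the bidding. -/
theorem bid {b : Fin n} (h : AuctionInvariant L T W o d ((b : ℕ) + 1) count) {k : Fin m}
    (hkT : k ∈ T) (hbk : L b k = true) (hk : d k ≤ m)
    (hmin : ∀ k' ∈ T, L b k' = true → d k ≤ d k') :
    AuctionInvariant L T W (Function.update o k ((b : ℕ) + 1)) (Function.update d k (d k + 1))
      (o k) count := by
  have hbW : b ∈ W ∧ ∀ k, o k ≠ (b : ℕ) + 1 := by
    rcases h.hand with h0 | ⟨b', hb', he, hno⟩
    · omega
    · have : b' = b := Fin.ext (by omega)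
      exact ⟨this ▸ hb', hno⟩
  have hd : ∀ l, d l ≤ Function.update d k (d k + 1) l := by
    intro l
    by_cases hl : l = k
    · subst hl; simp
    · simp [hl]
  refine ⟨fun l => ?_, ?_, fun l l' => ?_, fun l b' => ?_, fun l => ?_, fun b' hb' h1 h2 => ?_, ?_,
    fun l => ?_⟩
  · by_cases hl : l = k
    · subst hl
      exact Or.inr ⟨b, hbW.1, by simp, hkT, hbk⟩
    · simpa [hl] using h.assigned l
  · rcases h.assigned k with h0 | ⟨b', hb', he, -⟩
    · exact Or.inl h0
    · refine Or.inr ⟨b', hb', he, fun l => ?_⟩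
      by_cases hl : l = k
      · subst hl
        simpa using (hbW.2 l).symm
      · rw [Function.update_of_ne hl]
        exact fun heq => hl (h.inj k l (by omega) heq.symm).symm
  · by_cases hl : l = k <;> by_cases hl' : l' = k
    · intros
      rw [hl, hl']
    · subst hl
      rw [Function.update_self, Function.update_of_ne hl']
      exact fun _ he => absurd he.symm (hbW.2 l')
    · subst hl'
      rw [Function.update_self, Function.update_of_ne hl]
      exact fun _ he => absurd he (hbW.2 l)
    · rw [Function.update_of_ne hl, Function.update_of_ne hl']
      exact h.inj l l'
  · intro he k' hk' hl'
    refine le_trans ?_ (Nat.add_le_add_right (hd k') 1)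
    by_cases hl : l = k
    · subst hl
      rw [Function.update_self] at he ⊢
      have : b' = b := Fin.ext (by omega)
      exact Nat.add_le_add_right (hmin k' hk' (this ▸ hl')) 1
    · rw [Function.update_of_ne hl] at he ⊢
      exact h.cheap l b' he k' hk' hl'
  · by_cases hl : l = k
    · subst hl
      simp
    · rw [Function.update_of_ne hl, Function.update_of_ne hl]
      exact h.free l
  · have hb'b : b' ≠ b := by
      rintro rfl
      exact h1 k (by simp)
    refine fun l hl hbl => (h.rejected b' hb' (fun l' he => ?_)
      (fun he => hb'b (Fin.ext (by omega))) l hl hbl).trans (hd l)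
    by_cases hl' : l' = k
    · exact h2 (hl' ▸ he)
    · exact h1 l' (by rwa [Function.update_of_ne hl'])
  · have hc := h.count_eq
    have e1 : (Finset.univ.filter fun l => Function.update o k ((b : ℕ) + 1) l ≠ 0) =
        insert k (Finset.univ.filter fun l => o l ≠ 0) := by
      ext l
      by_cases hl : l = k
      · subst hl; simp
      · simp [hl]
    rw [e1]
    simp only [Nat.add_eq_zero_iff, one_ne_zero, and_false, if_false] at hc
    by_cases h0 : o k = 0
    · rw [Finset.card_insert_of_notMem (by simp [h0]), if_pos h0]
      omega
    · rw [Finset.insert_eq_of_mem (by simp [h0]), if_neg h0]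
      omega
  · by_cases hl : l = k
    · subst hl
      simpa using hk
    · simpa [hl] using h.level_le l

/-- There is a level that no seller has, which gives a vertex cover as large as the matching. -/
theorem count_add_matchRank (h : AuctionInvariant L T W o d 0 count) :
    count + matchRank L W T = W.card := by
  have hc := h.count_eq
  rw [if_pos rfl] at hc
  suffices hr : matchRank L W T = (Finset.univ.filter fun k => o k ≠ 0).card by omega
  set M := Finset.univ.filter fun k => o k ≠ 0 with hM
  rcases isEmpty_or_nonempty (Fin n) with hn | hn
  · have h1 := matchRank_le_card L W T
    have h2 : W.card = 0 := by simp [Finset.eq_empty_of_isEmpty W]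
    omega
  have hown : ∀ k ∈ M, ∃ b ∈ W, o k = (b : ℕ) + 1 ∧ k ∈ T ∧ L b k = true := fun k hk =>
    (h.assigned k).resolve_left (Finset.mem_filter.mp hk).2
  choose! f hfW hfo hfT hfL using hown
  have hfinj : Set.InjOn f M := by
    intro k hk k' hk' he
    refine h.inj k k' (Finset.mem_filter.mp hk).2 ?_
    rw [hfo k hk, hfo k' hk', he]
  apply le_antisymm
  -- The `m` goods cannot occupy all `m + 1` positive levels.
  · obtain ⟨l, hl, hgap⟩ : ∃ l < m + 1, ∀ k, d k ≠ l + 1 := by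
      by_contra hno
      push Not at hno
      have h1 : Finset.range (m + 1) ⊆ Finset.univ.image fun k => d k - 1 := by
        intro l hl
        obtain ⟨k, hk⟩ := hno l (Finset.mem_range.mp hl)
        exact Finset.mem_image.mpr ⟨k, Finset.mem_univ k, by omega⟩
      have h2 := (Finset.card_le_card h1).trans Finset.card_image_le
      rw [Finset.card_range, Finset.card_univ, Fintype.card_fin] at h2
      omega
    -- A buyer outside `A` has a linked good of level at most `l`, so she was not rejected; the good
    -- she holds has level at most `l + 1`, hence at most `l` by the gap. Neighbors of `A` have
    -- positive level, hence are held. So the cover charges distinct goods of the matching.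
    set A := W.filter fun b => ∀ k ∈ T, L b k = true → l < d k with hA
    refine (matchRank_le L W T A).trans ?_
    rw [← Finset.card_filter_add_card_filter_not (s := M) (fun k => d k ≤ l)]
    refine add_le_add ?_ (Finset.card_le_card fun k hk => ?_)
    · refine (Finset.card_le_card (t := (M.filter fun k => d k ≤ l).image f)
        fun b hb => ?_).trans Finset.card_image_le
      obtain ⟨hbW, hbA⟩ := Finset.mem_sdiff.mp hb
      have : ∃ k ∈ T, L b k = true ∧ d k ≤ l := by
        by_contra hno
        push Not at hno
        exact hbA (Finset.mem_filter.mpr ⟨hbW, hno⟩)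
      obtain ⟨k, hkT, hbk, hk⟩ := this
      have : ∃ k', o k' = (b : ℕ) + 1 := by
        by_contra hno
        push Not at hno
        have := h.rejected b hbW hno (by omega) k hkT hbk
        omega
      obtain ⟨k', hk'⟩ := this
      have hk'M : k' ∈ M := Finset.mem_filter.mpr ⟨Finset.mem_univ _, by omega⟩
      have h1 := h.cheap k' b hk' k hkT hbk
      have h2 := hgap k'
      refine Finset.mem_image.mpr ⟨k', Finset.mem_filter.mpr ⟨hk'M, by omega⟩, Fin.ext ?_⟩
      have := hfo k' hk'M
      omega
    · obtain ⟨hkT, b, hb, hbk⟩ := mem_neighbors.mp hk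
      have h1 := (Finset.mem_filter.mp hb).2 k hkT hbk
      refine Finset.mem_filter.mpr ⟨Finset.mem_filter.mpr ⟨Finset.mem_univ _, fun h0 => ?_⟩,
        not_le.mpr h1⟩
      have := h.free k h0
      omega
  · obtain ⟨A, hA⟩ := exists_coverCard_eq L W T
    rw [← hA, ← Finset.card_image_of_injOn hfinj]
    have hinv : ∀ b ∈ M.image f, ∃ k ∈ M, f k = b := fun b hb => by simpa using hb
    rcases M.eq_empty_or_nonempty with hM0 | ⟨k₀, -⟩
    · simp [hM0]
    have : Nonempty (Fin m) := ⟨k₀⟩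
    choose! e heM he using hinv
    refine card_le_coverCard e (fun b hb => ?_) (fun b hb => ?_) (fun b hb b' hb' hbb => ?_) A
    · obtain ⟨k, hk, rfl⟩ := Finset.mem_image.mp hb
      exact hfW k hk
    · refine ⟨hfT _ (heM b hb), ?_⟩
      have := hfL _ (heM b hb)
      rwa [he b hb] at this
    · rw [← he b hb, ← he b' hb', hbb]

end AuctionInvariant

/-! ## Reasoning about programs -/

/-- Started in memory `s`, the program `p` halts within `T` steps in a memory satisfying `Post`. -/
def Halts (inp : ℕ → ℝ) (p : Program) (T : ℕ) (s : Memory) (Post : Memory → Prop) : Prop :=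
  ∃ t s', Runs inp p s t s' ∧ t ≤ T ∧ Post s'

/-- The arrays of natural numbers to which `p` may write. -/
def Program.natWrites : Program → List ℕ
  | skip => []
  | setNat a _ _ => [a]
  | setReal _ _ _ => []
  | seq p q => p.natWrites ++ q.natWrites
  | ite _ p q => p.natWrites ++ q.natWrites
  | .while _ p => p.natWrites

/-- The arrays of real numbers to which `p` may write. -/
def Program.realWrites : Program → List ℕ
  | skip => []
  | setNat _ _ _ => []
  | setReal a _ _ => [a]
  | seq p q => p.realWrites ++ q.realWrites
  | ite _ p q => p.realWrites ++ q.realWrites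
  | .while _ p => p.realWrites

/-- The memories `s` and `s'` differ only in arrays to which `p` may write. -/
def Program.Frame (p : Program) (s s' : Memory) : Prop :=
  (∀ a ∉ p.natWrites, s'.nat a = s.nat a) ∧ ∀ a ∉ p.realWrites, s'.real a = s.real a

namespace Memory

variable (s : Memory) (a k x : ℕ) (r : ℝ)

@[simp]
theorem setNat_nat :
    (s.setNat a k x).nat = Function.update s.nat a (Function.update (s.nat a) k x) := rfl

@[simp]
theorem setNat_real : (s.setNat a k x).real = s.real := rfl

@[simp]
theorem setReal_nat : (s.setReal a k r).nat = s.nat := rfl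

@[simp]
theorem setReal_real :
    (s.setReal a k r).real = Function.update s.real a (Function.update (s.real a) k r) := rfl

end Memory

theorem Runs.frame {inp : ℕ → ℝ} {p : Program} {s s' : Memory} {t : ℕ} (h : Runs inp p s t s') :
    p.Frame s s' := by
  induction h with
  | skip s => exact ⟨fun _ _ => rfl, fun _ _ => rfl⟩
  | setNat a idx e s =>
    refine ⟨fun b hb => ?_, fun _ _ => rfl⟩
    have : b ≠ a := by simpa [Program.natWrites] using hb
    simp [this]
  | setReal a idx r s =>
    refine ⟨fun _ _ => rfl, fun b hb => ?_⟩
    have : b ≠ a := by simpa [Program.realWrites] using hb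
    simp [this]
  | seq _ _ ih1 ih2 =>
    refine ⟨fun b hb => ?_, fun b hb => ?_⟩
    · simp only [Program.natWrites, List.mem_append, not_or] at hb
      rw [ih2.1 b hb.2, ih1.1 b hb.1]
    · simp only [Program.realWrites, List.mem_append, not_or] at hb
      rw [ih2.2 b hb.2, ih1.2 b hb.1]
  | ite_true _ _ ih =>
    refine ⟨fun b hb => ?_, fun b hb => ?_⟩
    · simp only [Program.natWrites, List.mem_append, not_or] at hb
      exact ih.1 b hb.1
    · simp only [Program.realWrites, List.mem_append, not_or] at hb
      exact ih.2 b hb.1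
  | ite_false _ _ ih =>
    refine ⟨fun b hb => ?_, fun b hb => ?_⟩
    · simp only [Program.natWrites, List.mem_append, not_or] at hb
      exact ih.1 b hb.2
    · simp only [Program.realWrites, List.mem_append, not_or] at hb
      exact ih.2 b hb.2
  | while_true _ _ _ ih1 ih2 =>
    refine ⟨fun b hb => ?_, fun b hb => ?_⟩
    · rw [ih2.1 b hb, ih1.1 b hb]
    · rw [ih2.2 b hb, ih1.2 b hb]
  | while_false _ => exact ⟨fun _ _ => rfl, fun _ _ => rfl⟩

namespace Halts

variable {inp : ℕ → ℝ} {p q : Program} {b : Test} {T T' : ℕ} {s : Memory}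
  {Post Post' : Memory → Prop}

theorem mono (h : Halts inp p T s Post) (hT : T ≤ T') (hP : ∀ s', Post s' → Post' s') :
    Halts inp p T' s Post' :=
  let ⟨t, s', hr, ht, hp⟩ := h
  ⟨t, s', hr, ht.trans hT, hP s' hp⟩

theorem skip (h : Post s) : Halts inp Program.skip 1 s Post :=
  ⟨1, s, .skip s, le_rfl, h⟩

theorem setNat {a : ℕ} {idx e : NatExpr} (h : Post (s.setNat a (idx.eval s) (e.eval s))) :
    Halts inp (Program.setNat a idx e) 1 s Post :=
  ⟨1, _, .setNat a idx e s, le_rfl, h⟩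

theorem setReal {a : ℕ} {idx : NatExpr} {r : RealExpr}
    (h : Post (s.setReal a (idx.eval s) (r.eval inp s))) :
    Halts inp (Program.setReal a idx r) 1 s Post :=
  ⟨1, _, .setReal a idx r s, le_rfl, h⟩

theorem seq {Mid : Memory → Prop} (hp : Halts inp p T s Mid)
    (hq : ∀ s', Mid s' → p.Frame s s' → Halts inp q T' s' Post) :
    Halts inp (Program.seq p q) (T + T') s Post := by
  obtain ⟨t, s', hr, ht, hm⟩ := hp
  obtain ⟨t', s'', hr', ht', hm'⟩ := hq s' hm hr.frame
  exact ⟨t + t', s'', hr.seq hr', add_le_add ht ht', hm'⟩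

theorem setNat_seq {a : ℕ} {idx e : NatExpr}
    (h : Halts inp q T (s.setNat a (idx.eval s) (e.eval s)) Post) :
    Halts inp (Program.seq (Program.setNat a idx e) q) (1 + T) s Post :=
  seq (Mid := (· = s.setNat a (idx.eval s) (e.eval s))) (setNat rfl) fun _ h' _ => h' ▸ h

theorem setReal_seq {a : ℕ} {idx : NatExpr} {r : RealExpr}
    (h : Halts inp q T (s.setReal a (idx.eval s) (r.eval inp s)) Post) :
    Halts inp (Program.seq (Program.setReal a idx r) q) (1 + T) s Post :=
  seq (Mid := (· = s.setReal a (idx.eval s) (r.eval inp s))) (setReal rfl) fun _ h' _ => h' ▸ h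

theorem ite (hp : b.Holds inp s → Halts inp p T s Post)
    (hq : ¬ b.Holds inp s → Halts inp q T s Post) :
    Halts inp (Program.ite b p q) (T + 1) s Post := by
  by_cases hb : b.Holds inp s
  · obtain ⟨t, s', hr, ht, hm⟩ := hp hb
    exact ⟨t + 1, s', .ite_true hb hr, Nat.add_le_add_right ht 1, hm⟩
  · obtain ⟨t, s', hr, ht, hm⟩ := hq hb
    exact ⟨t + 1, s', .ite_false hb hr, Nat.add_le_add_right ht 1, hm⟩

theorem while_of_variant (I : Memory → Prop) (V : Memory → ℕ) {K : ℕ} (hI : I s) (hK : V s ≤ K)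
    (step : ∀ s', I s' → b.Holds inp s' → (Program.while b p).Frame s s' →
      Halts inp p T s' fun s'' => I s'' ∧ V s'' < V s')
    (post : ∀ s', I s' → ¬ b.Holds inp s' → Post s') :
    Halts inp (Program.while b p) (K * (T + 1) + 1) s Post := by
  suffices H : ∀ k s', V s' ≤ k → I s' → (Program.while b p).Frame s s' →
      Halts inp (Program.while b p) (k * (T + 1) + 1) s' Post from
    H K s hK hI ⟨fun _ _ => rfl, fun _ _ => rfl⟩
  intro k
  induction k with
  | zero =>
    intro s' hV hI hF
    by_cases hb : b.Holds inp s'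
    · obtain ⟨t, s'', hr, ht, hI'', hlt⟩ := step s' hI hb hF
      omega
    · exact ⟨1, s', .while_false hb, by omega, post s' hI hb⟩
  | succ k ih =>
    intro s' hV hI hF
    by_cases hb : b.Holds inp s'
    · obtain ⟨t, s'', hr, ht, hI'', hlt⟩ := step s' hI hb hF
      have hF' := hr.frame
      obtain ⟨t', s₃, hr', ht', hp⟩ := ih s'' (by omega) hI''
        ⟨fun a ha => (hF'.1 a ha).trans (hF.1 a ha), fun a ha => (hF'.2 a ha).trans (hF.2 a ha)⟩
      refine ⟨t + t' + 1, s₃, .while_true hb hr hr', ?_, hp⟩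
      rw [Nat.add_mul]
      omega
    · exact ⟨1, s', .while_false hb, by omega, post s' hI hb⟩

end Halts

/-- Run `body` with `0, 1, …` in the cell `(c, 0)`, up to the bound in the cell `(0, w)`. -/
def forLoop (c w : ℕ) (body : Program) : Program :=
  .seq (.setNat c (.const 0) (.const 0))
    (.while (.natLE (.add (.get c (.const 0)) (.const 1)) (.get 0 (.const w)))
      (.seq body (.setNat c (.const 0) (.add (.get c (.const 0)) (.const 1)))))

/-- The frame relative to the start of the loop is passed to `step` and `post`, so an invariant need
only mention the cells that change. -/
theorem Halts.forLoop {inp : ℕ → ℝ} {c w N T : ℕ} {body : Program} {s : Memory}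
    {Post : Memory → Prop} (I : ℕ → Memory → Prop) (hN : s.nat 0 w = N) (hc : c ≠ 0)
    (hcw : c ∉ body.natWrites) (h0w : 0 ∉ body.natWrites)
    (init : I 0 (s.setNat c 0 0))
    (step : ∀ k < N, ∀ s', s'.nat c 0 = k → (PlatformMarket.forLoop c w body).Frame s s' →
      I k s' → Halts inp body T s' fun s'' => I (k + 1) (s''.setNat c 0 (k + 1)))
    (post : ∀ s', (PlatformMarket.forLoop c w body).Frame s s' → I N s' → Post s') :
    Halts inp (PlatformMarket.forLoop c w body) (N * (T + 2) + 2) s Post := by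
  set W := Test.natLE (.add (.get c (.const 0)) (.const 1)) (.get 0 (.const w)) with hW
  have hF : ∀ s', (Program.while W
      (.seq body (.setNat c (.const 0) (.add (.get c (.const 0)) (.const 1))))).Frame
        (s.setNat c 0 0) s' → (PlatformMarket.forLoop c w body).Frame s s' := by
    intro s' h
    refine ⟨fun a ha => ?_, fun a ha => ?_⟩
    · simp only [PlatformMarket.forLoop, Program.natWrites, List.cons_append, List.nil_append,
        List.mem_cons, List.mem_append, List.not_mem_nil, or_false, not_or] at ha
      rw [h.1 a (by simp [Program.natWrites, ha])]
      simp [ha.1]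
    · rw [h.2 a (by simpa [PlatformMarket.forLoop, Program.realWrites] using ha)]
      simp
  have hbound : ∀ s', (PlatformMarket.forLoop c w body).Frame s s' → s'.nat 0 w = N := by
    intro s' h
    rw [h.1 0 (by simp [PlatformMarket.forLoop, Program.natWrites, h0w, hc.symm]), hN]
  have := Halts.while_of_variant (inp := inp) (b := W) (s := s.setNat c 0 0) (T := T + 1) (K := N)
    (p := .seq body (.setNat c (.const 0) (.add (.get c (.const 0)) (.const 1)))) (Post := Post)
    (fun s' => s'.nat c 0 ≤ N ∧ I (s'.nat c 0) s' ∧ (PlatformMarket.forLoop c w body).Frame s s')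
    (fun s' => N - s'.nat c 0)
    ⟨by simp, by simpa using init, hF _ ⟨fun _ _ => rfl, fun _ _ => rfl⟩⟩ (by simp) ?_ ?_
  · refine Halts.mono (Halts.setNat_seq this) ?_ fun _ h => h
    have : N * (T + 1 + 1) = N * (T + 2) := rfl
    omega
  · rintro s' ⟨hk, hI, -⟩ hb hF'
    have hlt : s'.nat c 0 < N := by
      have := hbound s' (hF s' hF')
      simpa [hW, Test.Holds, NatExpr.eval, this, Nat.succ_le_iff] using hb
    refine Halts.seq (step _ hlt s' rfl (hF s' hF') hI) fun s'' h hfr => Halts.setNat ?_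
    have hc'' : s''.nat c 0 = s'.nat c 0 := by rw [hfr.1 c hcw]
    simp only [NatExpr.eval, hc'']
    refine ⟨⟨by simp; omega, by simpa using h, ?_⟩, by simp; omega⟩
    refine hF _ ⟨fun a ha => ?_, fun a ha => ?_⟩
    · have ha' := ha
      simp only [Program.natWrites, List.mem_append, List.mem_cons, List.not_mem_nil, or_false,
        not_or] at ha
      simp only [Memory.setNat_nat]
      rw [Function.update_of_ne ha.2, hfr.1 a ha.1, hF'.1 a ha']
      rfl
    · have ha' := ha
      simp only [Program.realWrites, List.append_nil] at ha
      rw [Memory.setNat_real, hfr.2 a ha, hF'.2 a ha']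
  · rintro s' ⟨hk, hI, hfr⟩ hb
    have hle : ¬ s'.nat c 0 + 1 ≤ N := by
      have := hbound s' hfr
      simpa [hW, Test.Holds, NatExpr.eval, this] using hb
    have : s'.nat c 0 = N := by omega
    exact post s' hfr (this ▸ hI)

/-! ## The program

Arrays of naturals: `0` holds `n, m`, `1` the graph, `2` the platform, `3` the offsets of the rows of
the graph, `5` the levels, `6` the holders of the goods, `7` the bidding buyer, `8` her preferred
seller, `9` the number of buyers who gave up, `10`, `11`, `12`, `16` loop counters, `13` an excluded
seller, `14` the seller whose price is computed, `15` and `19` auxiliary numbers, `17` the selected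
seller, `18` whether the loop is left. Arrays of reals: `0` a price, `1` the price of the selected seller. -/

/-- The first cell of array `a`. -/
def NatExpr.var (a : ℕ) : NatExpr := .get a (.const 0)

/-- The predecessor. -/
def NatExpr.pred (e : NatExpr) : NatExpr := .sub e (.const 1)

/-- The successor. -/
def NatExpr.succ (e : NatExpr) : NatExpr := .add e (.const 1)

/-- The bidding buyer can buy from the seller in cell `10`, who is not excluded. -/
def linkTest : Test :=
  .and (.not (.and (.natLE (.get 2 (.var 10)) (.const 0))
      (.natLE (.get 1 (.add (.get 3 (.pred (.var 7))) (.var 10))) (.const 0))))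
    (.not (.and (.natLE (.var 10) (.var 13)) (.natLE (.var 13) (.var 10))))

/-- Find a seller of lowest level for the bidding buyer. -/
def cheapestProg : Program :=
  .seq (.setNat 8 (.const 0) (.const 0)) (forLoop 10 1
    (.ite (.and linkTest (.not (.and (.natLE (.const 1) (.var 8))
        (.natLE (.get 5 (.pred (.var 8))) (.get 5 (.var 10))))))
      (.setNat 8 (.const 0) (.succ (.var 10))) .skip))

/-- The buyer bids, replacing the holder of the good, or gives up. -/
def bidProg : Program :=
  .seq cheapestProg
    (.ite (.and (.natLE (.const 1) (.var 8)) (.natLE (.get 5 (.pred (.var 8))) (.get 0 (.const 1))))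
      (.seq (.setNat 15 (.const 0) (.get 6 (.pred (.var 8))))
        (.seq (.setNat 6 (.pred (.var 8)) (.var 7))
          (.seq (.setNat 7 (.const 0) (.var 15))
            (.setNat 5 (.pred (.var 8)) (.succ (.get 5 (.pred (.var 8))))))))
      (.seq (.setNat 9 (.const 0) (.succ (.var 9))) (.setNat 7 (.const 0) (.const 0))))

/-- Run the auction for the buyers whose value is at least that of the buyer in cell `12`. -/
def auctionProg : Program :=
  .seq (.setNat 9 (.const 0) (.const 0))
    (.seq (.setNat 7 (.const 0) (.const 0))
      (.seq (forLoop 10 1 (.seq (.setNat 5 (.var 10) (.const 0)) (.setNat 6 (.var 10) (.const 0))))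
        (forLoop 11 0
          (.ite (.realLE (.input (.succ (.var 12))) (.input (.succ (.var 11))))
            (.seq (.setNat 7 (.const 0) (.succ (.var 11)))
              (.while (.natLE (.const 1) (.var 7)) bidProg))
            .skip))))

/-- Compute the price of the seller in cell `14`. -/
def priceProg : Program :=
  .seq (.setReal 0 (.const 0) (.const 0))
    (forLoop 12 0
      (.seq (.setNat 13 (.const 0) (.get 0 (.const 1)))
        (.seq auctionProg
          (.seq (.setNat 19 (.const 0) (.var 9))
            (.seq (.setNat 13 (.const 0) (.var 14))
              (.seq auctionProg
                (.ite (.and (.natLE (.succ (.var 19)) (.var 9))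
                    (.realLE (.get 0 (.const 0)) (.input (.succ (.var 12)))))
                  (.setReal 0 (.const 0) (.input (.succ (.var 12)))) .skip)))))))

/-- Find a seller of lowest price outside the platform. -/
def selectProg : Program :=
  .seq (.setNat 17 (.const 0) (.const 0)) (forLoop 16 1
    (.ite (.natLE (.get 2 (.var 16)) (.const 0))
      (.seq (.setNat 14 (.const 0) (.var 16))
        (.seq priceProg
          (.ite (.and (.natLE (.const 1) (.var 17))
              (.realLE (.get 1 (.const 0)) (.get 0 (.const 0)))) .skip
            (.seq (.setNat 17 (.const 0) (.succ (.var 16)))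
              (.setReal 1 (.const 0) (.get 0 (.const 0)))))))
      .skip))

/-- One pass through the loop of the greedy algorithm. -/
def stepProg : Program :=
  .seq selectProg
    (.ite (.natLE (.var 17) (.const 0)) (.setNat 18 (.const 0) (.const 1))
      (.seq (.setNat 2 (.pred (.var 17)) (.const 1))
        (.seq (.setNat 14 (.const 0) (.pred (.var 17)))
          (.seq priceProg
            (.ite (.realLE (.get 1 (.const 0))
                (.sub (.get 0 (.const 0)) (.scale (.const 0) (.get 0 (.const 0))))) .skip
              (.seq (.setNat 2 (.pred (.var 17)) (.const 0))
                (.setNat 18 (.const 0) (.const 1))))))))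

/-- The greedy algorithm. -/
def greedyProg : Program :=
  .seq (forLoop 10 0 (.setNat 3 (.succ (.var 10))
      (.add (.get 3 (.var 10)) (.get 0 (.const 1)))))
    (.while (.natLE (.var 18) (.const 0)) stepProg)

/-! ### Running times -/

section Time

variable {R : Type*} [CommSemiring R] (n m : R)

/-- The bounds live in an arbitrary commutative semiring, so the same expressions serve as numbers
and as polynomials. -/
def cheapestTime : R := 1 + (m * (2 + 2) + 2)

def bidTime : R := cheapestTime m + 5

def auctionTime : R :=
  1 + (1 + ((m * (2 + 2) + 2) + (n * ((1 + ((m * (m + 1) + 1) * (bidTime m + 1) + 1) + 1) + 2) + 2)))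

def priceTime : R :=
  1 + (n * ((1 + (auctionTime n m + (1 + (1 + (auctionTime n m + 2))))) + 2) + 2)

def selectTime : R := 1 + (m * ((1 + (priceTime n m + 3) + 1) + 2) + 2)

def stepTime : R := selectTime n m + (1 + (1 + (priceTime n m + 3)) + 1)

def greedyTime : R := (n * (1 + 2) + 2) + ((m + 1) * (stepTime n m + 1) + 1)

end Time

attribute [local simp] NatExpr.eval RealExpr.eval Test.Holds NatExpr.var NatExpr.succ NatExpr.pred

/-- The memory holds the market and the platform `P`. -/
structure Ready {n m : ℕ} (g : Fin n → Fin m → Bool) (P : Finset (Fin m)) (s : Memory) : Prop where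
  buyers : s.nat 0 0 = n
  sellers : s.nat 0 1 = m
  graph : ∀ (i : Fin n) (j : Fin m), s.nat 1 ((i : ℕ) * m + (j : ℕ)) = (g i j).toNat
  offset : ∀ i : Fin n, s.nat 3 i = (i : ℕ) * m
  platform : outputSet m s = P

theorem mem_outputSet {m : ℕ} {s : Memory} {j : Fin m} :
    j ∈ outputSet m s ↔ s.nat 2 (j : ℕ) ≠ 0 := by
  simp [outputSet]

theorem outputSet_congr {m : ℕ} {s s' : Memory} (h : s'.nat 2 = s.nat 2) :
    outputSet m s' = outputSet m s := by
  simp [outputSet, h]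

theorem Ready.congr {n m : ℕ} {g : Fin n → Fin m → Bool} {P : Finset (Fin m)} {s s' : Memory}
    (h : Ready g P s) (h0 : s'.nat 0 = s.nat 0) (h1 : s'.nat 1 = s.nat 1)
    (h2 : s'.nat 2 = s.nat 2) (h3 : s'.nat 3 = s.nat 3) : Ready g P s' :=
  ⟨h0 ▸ h.buyers, h0 ▸ h.sellers, h1 ▸ h.graph, h3 ▸ h.offset,
    (outputSet_congr h2).trans h.platform⟩

/-- All sellers but the one excluded. -/
def sellersExcept (m e : ℕ) : Finset (Fin m) := Finset.univ.filter fun k => (k : ℕ) ≠ e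

/-! ### Correctness of the auction program -/

section Correct

variable {n m : ℕ} {g : Fin n → Fin m → Bool} {P : Finset (Fin m)} {inp : ℕ → ℝ} {s : Memory}

theorem linkTest_holds_iff (h : Ready g P s) {b : Fin n} {k : Fin m} (hb : s.nat 7 0 = (b : ℕ) + 1)
    (hk : s.nat 10 0 = k) :
    linkTest.Holds inp s ↔
      k ∈ sellersExcept m (s.nat 13 0) ∧ joinLink g P b k = true := by
  have h1 : s.nat 1 (s.nat 3 b + k) = (g b k).toNat := by rw [h.offset, h.graph]
  rw [joinLink_eq_true, ← h.platform, mem_outputSet]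
  simp only [linkTest, Test.Holds, NatExpr.eval, NatExpr.var, NatExpr.pred, hb, hk,
    Nat.add_sub_cancel, h1, sellersExcept, Finset.mem_filter, Finset.mem_univ, true_and]
  cases g b k <;> simp <;> omega

theorem cheapestProg_halts (h : Ready g P s) {b : Fin n} (hb : s.nat 7 0 = (b : ℕ) + 1) :
    Halts inp cheapestProg (cheapestTime m) s fun s' =>
      (s'.nat 8 0 = 0 ∧ ∀ k ∈ sellersExcept m (s.nat 13 0), joinLink g P b k = false) ∨
      ∃ k : Fin m, s'.nat 8 0 = (k : ℕ) + 1 ∧ k ∈ sellersExcept m (s.nat 13 0) ∧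
        joinLink g P b k = true ∧ ∀ k' ∈ sellersExcept m (s.nat 13 0),
          joinLink g P b k' = true → s.nat 5 k ≤ s.nat 5 k' := by
  refine Halts.setNat_seq (Halts.forLoop (N := m) (T := 2)
    (fun l s' => (s'.nat 8 0 = 0 ∧ ∀ k ∈ sellersExcept m (s.nat 13 0), (k : ℕ) < l →
        joinLink g P b k = false) ∨
      ∃ k : Fin m, s'.nat 8 0 = (k : ℕ) + 1 ∧ k ∈ sellersExcept m (s.nat 13 0) ∧
        joinLink g P b k = true ∧ ∀ k' ∈ sellersExcept m (s.nat 13 0), (k' : ℕ) < l →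
          joinLink g P b k' = true → s.nat 5 k ≤ s.nat 5 k')
    (by simpa using h.sellers) (by decide) (by decide) (by decide) (by simp) ?_ ?_)
  · intro l hl s' hs' hF hI
    have e : ∀ a, a ≠ 8 → a ≠ 10 → s'.nat a = s.nat a := by
      intro a h8 h10
      rw [hF.1 a (by simp [forLoop, Program.natWrites, h8, h10])]
      simp [h8]
    have hR : Ready g P s' := h.congr (e _ (by decide) (by decide)) (e _ (by decide) (by decide))
      (e _ (by decide) (by decide)) (e _ (by decide) (by decide))
    have hlink := linkTest_holds_iff (inp := inp) (k := ⟨l, hl⟩) hR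
      (by rw [e 7 (by decide) (by decide), hb]) hs'
    rw [e 13 (by decide) (by decide)] at hlink
    have h5 := e 5 (by decide) (by decide)
    have hlt : ∀ k : Fin m, (k : ℕ) < l + 1 → (k : ℕ) < l ∨ k = ⟨l, hl⟩ := by
      intro k hk
      rcases Nat.lt_succ_iff_lt_or_eq.mp hk with hk | hk
      · exact Or.inl hk
      · exact Or.inr (Fin.ext hk)
    refine Halts.ite (fun hc => Halts.setNat ?_)
      (fun hc => Halts.skip ?_)
    · obtain ⟨hc1, hc2⟩ := hc
      obtain ⟨hm, hlk⟩ := hlink.mp hc1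
      refine Or.inr ⟨⟨l, hl⟩, by simp [hs'], hm, hlk, fun k' hk' hkl hl' => ?_⟩
      rcases hlt k' hkl with hkl | rfl
      · rcases hI with ⟨-, hI⟩ | ⟨k, hk, -, -, hmin⟩
        · rw [hI k' hk' hkl] at hl'
          exact absurd hl' (by simp)
        · have := hmin k' hk' hkl hl'
          simp [hk, hs', h5] at hc2
          simp only
          omega
      · exact le_rfl
    · rcases hI with ⟨h0, hI⟩ | ⟨k, hk, hkm, hkl, hmin⟩
      · refine Or.inl ⟨by simpa using h0, fun k hk hkl => ?_⟩
        rcases hlt k hkl with hkl | rfl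
        · exact hI k hk hkl
        · by_contra hne
          refine hc ⟨hlink.mpr ⟨hk, by simpa using hne⟩, ?_⟩
          simp [h0]
      · refine Or.inr ⟨k, by simpa using hk, hkm, hkl, fun k' hk' hkl' hl' => ?_⟩
        rcases hlt k' hkl' with hkl' | rfl
        · exact hmin k' hk' hkl' hl'
        · by_contra hgt
          refine hc ⟨hlink.mpr ⟨hk', hl'⟩, ?_⟩
          simp [hk, hs', h5]
          simpa using hgt
  · rintro s' - (⟨h0, hI⟩ | ⟨k, hk, hkm, hkl, hmin⟩)
    · exact Or.inl ⟨h0, fun k hk => hI k hk k.2⟩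
    · exact Or.inr ⟨k, hk, hkm, hkl, fun k' hk' => hmin k' hk' k'.2⟩

/-- The state of the auction in memory. -/
def AuctionState (g : Fin n → Fin m → Bool) (P : Finset (Fin m)) (e : ℕ) (W : Finset (Fin n))
    (s : Memory) : Prop :=
  AuctionInvariant (joinLink g P) (sellersExcept m e) W (fun k => s.nat 6 k) (fun k => s.nat 5 k)
    (s.nat 7 0) (s.nat 9 0)

/-- The number of bids that are still possible. -/
def auctionPotential (m : ℕ) (s : Memory) : ℕ :=
  ∑ k : Fin m, (m + 1 - s.nat 5 k) + if s.nat 7 0 = 0 then 0 else 1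

theorem update_comp_val (f : ℕ → ℕ) (k : Fin m) (x : ℕ) :
    (fun l : Fin m => Function.update f (k : ℕ) x l) =
      Function.update (fun l : Fin m => f l) k x := by
  funext l
  by_cases h : l = k
  · subst h; simp
  · rw [Function.update_of_ne h, Function.update_of_ne fun he => h (Fin.ext he)]

/-- A bid raises a level and cannot raise the hand term, which is already `1`; giving up leaves the
levels and clears the hand. Either way the potential drops. -/
theorem bidProg_halts (h : Ready g P s) {W : Finset (Fin n)}
    (hA : AuctionState g P (s.nat 13 0) W s) (hcur : s.nat 7 0 ≠ 0) :
    Halts inp bidProg (bidTime m) s fun s' =>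
      AuctionState g P (s.nat 13 0) W s' ∧ auctionPotential m s' < auctionPotential m s := by
  obtain ⟨b, -, hb, -⟩ := hA.hand.resolve_left hcur
  refine Halts.seq (cheapestProg_halts h hb) fun s' hs' hF => ?_
  have e : ∀ a, a ≠ 8 → a ≠ 10 → s'.nat a = s.nat a := by
    intro a h8 h10
    exact hF.1 a (by simp [cheapestProg, forLoop, Program.natWrites, h8, h10])
  have e0 := e 0 (by decide) (by decide)
  have e5 := e 5 (by decide) (by decide)
  have e6 := e 6 (by decide) (by decide)
  have e7 := e 7 (by decide) (by decide)
  have e9 := e 9 (by decide) (by decide)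
  unfold AuctionState at hA
  rw [hb] at hA
  refine Halts.ite (fun hc => ?_) (fun hc => ?_)
  · rcases hs' with ⟨h0, -⟩ | ⟨k, hk, hkm, hkl, hmin⟩
    · simp [h0] at hc
    have hd : s.nat 5 k ≤ m := by simpa [hk, e5, e0, h.sellers] using hc
    refine Halts.setNat_seq (Halts.setNat_seq (Halts.setNat_seq (Halts.setNat ?_)))
    have key := hA.bid hkm hkl hd hmin
    rw [← update_comp_val, ← update_comp_val] at key
    constructor
    · simpa [AuctionState, hk, e5, e6, e7, e9, hb] using key
    · have hsum : ∑ l : Fin m, (m + 1 - Function.update (s.nat 5) (k : ℕ) (s.nat 5 k + 1) l) <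
          ∑ l : Fin m, (m + 1 - s.nat 5 l) := by
        refine Finset.sum_lt_sum (fun l _ => ?_) ⟨k, Finset.mem_univ k, ?_⟩
        · by_cases hl : (l : ℕ) = k
          · rw [hl, Function.update_self]
            omega
          · rw [Function.update_of_ne hl]
        · rw [Function.update_self]
          omega
      simp only [auctionPotential, hb]
      simp [hk, e5, e6, e7]
      split_ifs <;> omega
  · have hb' : ∀ k ∈ sellersExcept m (s.nat 13 0), joinLink g P b k = true →
        m + 1 ≤ s.nat 5 k := by
      intro k' hk' hkl'
      rcases hs' with ⟨-, hno⟩ | ⟨k, hk, hkm, hkl, hmin⟩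
      · rw [hno k' hk'] at hkl'
        exact absurd hkl' (by simp)
      · have h1 := hmin k' hk' hkl'
        have h2 : m < s.nat 5 k := by simpa [hk, e5, e0, h.sellers] using hc
        omega
    refine Halts.mono (T := 1 + 1) (Halts.setNat_seq (Halts.setNat ?_)) (by omega) fun _ h => h
    constructor
    · simpa [AuctionState, e5, e6, e9] using hA.giveUp hb'
    · simp [auctionPotential, e5, hb]

theorem auctionPotential_le (s : Memory) : auctionPotential m s ≤ m * (m + 1) + 1 := by
  unfold auctionPotential
  refine add_le_add ((Finset.sum_le_card_nsmul _ _ (m + 1) fun k _ => by omega).trans ?_) ?_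
  · simp
  · split_ifs <;> omega

theorem realInput_succ (α : ℝ) (v : Fin n → ℝ) {k : ℕ} (hk : k < n) :
    realInput α v (k + 1) = v ⟨k, hk⟩ := by
  simp [realInput, hk]

/-- Exactly the buyers of the level set enter, one at a time, and bidding continues until no buyer
is in hand; then `count_add_matchRank` converts the number of quitters into the rank. -/
theorem auctionProg_halts {α : ℝ} {v : Fin n → ℝ} (h : Ready g P s) {i : Fin n}
    (hi : s.nat 12 0 = i) :
    Halts (realInput α v) auctionProg (auctionTime n m) s fun s' =>
      s'.nat 9 0 + matchRank (joinLink g P) (levelSet v (v i)) (sellersExcept m (s.nat 13 0)) =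
        (levelSet v (v i)).card := by
  classical
  refine Halts.setNat_seq (Halts.setNat_seq (Halts.seq
    (Mid := AuctionState g P (s.nat 13 0) ∅) ?_ fun s₁ hs₁ hF₁ => ?_))
  · refine Halts.forLoop (N := m) (T := 2)
      (fun l s' => ∀ k : Fin m, (k : ℕ) < l → s'.nat 5 k = 0 ∧ s'.nat 6 k = 0)
      (by simpa using h.sellers) (by decide) (by decide) (by decide) (by simp) ?_ ?_
    · intro l hl s' hs' hF hI
      refine Halts.setNat_seq (Halts.setNat fun k hk => ?_)
      by_cases hkl : (k : ℕ) = l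
      · simp [hs', hkl]
      · have := hI k (by omega)
        simp [hs', hkl, this]
    · intro s' hF hI
      have h7 : s'.nat 7 0 = 0 := by
        rw [hF.1 7 (by decide)]
        simp
      have h9 : s'.nat 9 0 = 0 := by
        rw [hF.1 9 (by decide)]
        simp
      have h5 : (fun k : Fin m => s'.nat 5 k) = fun _ => 0 := funext fun k => (hI k k.2).1
      have h6 : (fun k : Fin m => s'.nat 6 k) = fun _ => 0 := funext fun k => (hI k k.2).2
      unfold AuctionState
      rw [h5, h6, h7, h9]
      exact AuctionInvariant.start _ _
  · have e₁ : ∀ a, a ∉ [5, 6, 7, 9, 10] → s₁.nat a = s.nat a := by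
      intro a ha
      simp only [List.mem_cons, List.not_mem_nil, or_false, not_or] at ha
      rw [hF₁.1 a (by simp [forLoop, Program.natWrites, ha])]
      simp [ha]
    refine Halts.forLoop (N := n) (T := (1 + ((m * (m + 1) + 1) * (bidTime m + 1) + 1) + 1))
      (fun l s' => s'.nat 7 0 = 0 ∧ AuctionState g P (s.nat 13 0)
        ((levelSet v (v i)).filter fun b : Fin n => (b : ℕ) < l) s')
      (by rw [e₁ 0 (by decide), h.buyers]) (by decide) (by decide) (by decide) ?_ ?_ ?_
    · refine ⟨?_, ?_⟩
      · simp [hF₁.1 7 (by decide)]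
      · simpa [AuctionState] using hs₁
    · intro l hl s₂ hl₂ hF₂ ⟨h7, hA⟩
      have e₂ : ∀ a, a ∉ [5, 6, 7, 8, 9, 10, 11, 15] → s₂.nat a = s.nat a := by
        intro a ha
        simp only [List.mem_cons, List.not_mem_nil, or_false, not_or] at ha
        rw [hF₂.1 a (by simp [forLoop, bidProg, cheapestProg, Program.natWrites, ha]),
          e₁ a (by simp [ha])]
      have htest : Test.Holds (realInput α v) s₂
          (.realLE (.input (.succ (.var 12))) (.input (.succ (.var 11)))) ↔
          v i ≤ v ⟨l, hl⟩ := by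
        simp only [Test.Holds, RealExpr.eval, NatExpr.succ, NatExpr.var, NatExpr.eval, hl₂,
          e₂ 12 (by decide), hi, realInput_succ α v i.2, realInput_succ α v hl]
      refine Halts.ite (fun hc => ?_) (fun hc => ?_)
      · have hins : (levelSet v (v i)).filter (fun b : Fin n => (b : ℕ) < l + 1) =
            insert ⟨l, hl⟩ ((levelSet v (v i)).filter fun b : Fin n => (b : ℕ) < l) := by
          ext b
          simp only [Finset.mem_filter, Finset.mem_insert, mem_levelSet, Fin.ext_iff]
          constructor
          · rintro ⟨hb, hlt⟩
            by_cases hbl : (b : ℕ) = l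
            · exact Or.inl hbl
            · exact Or.inr ⟨hb, by omega⟩
          · rintro (hbl | ⟨hb, hlt⟩)
            · have : b = ⟨l, hl⟩ := Fin.ext hbl
              exact ⟨this ▸ htest.mp hc, by omega⟩
            · exact ⟨hb, by omega⟩
        unfold AuctionState at hA
        rw [h7] at hA
        have hA' := hA.take (b := ⟨l, hl⟩) (by simp)
        rw [← hins] at hA'
        refine Halts.setNat_seq (Halts.while_of_variant
          (fun s' => AuctionState g P (s.nat 13 0)
            ((levelSet v (v i)).filter fun b : Fin n => (b : ℕ) < l + 1) s')
          (auctionPotential m) ?_ (auctionPotential_le _) ?_ ?_)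
        · simpa [AuctionState, hl₂] using hA'
        · intro s₃ hA₃ hc₃ hF₃
          have e₃ : ∀ a, a ∉ [5, 6, 7, 8, 9, 10, 11, 15] → s₃.nat a = s.nat a := by
            intro a ha
            rw [← e₂ a ha]
            simp only [List.mem_cons, List.not_mem_nil, or_false, not_or] at ha
            rw [hF₃.1 a (by simp [forLoop, bidProg, cheapestProg, Program.natWrites, ha])]
            simp [ha]
          have hR : Ready g P s₃ := h.congr (e₃ _ (by decide)) (e₃ _ (by decide))
            (e₃ _ (by decide)) (e₃ _ (by decide))
          have h13 := e₃ 13 (by decide)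
          have := bidProg_halts (inp := realInput α v) hR (W :=
            (levelSet v (v i)).filter fun b : Fin n => (b : ℕ) < l + 1) (by rw [h13]; exact hA₃)
            (by simpa [Nat.one_le_iff_ne_zero] using hc₃)
          rwa [h13] at this
        · intro s₃ hA₃ hc₃
          have h7 : s₃.nat 7 0 = 0 := by simpa using hc₃
          exact ⟨by simpa using h7, by simpa [AuctionState] using hA₃⟩
      · have hsame : (levelSet v (v i)).filter (fun b : Fin n => (b : ℕ) < l + 1) =
            (levelSet v (v i)).filter fun b : Fin n => (b : ℕ) < l := by
          ext b
          simp only [Finset.mem_filter, mem_levelSet]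
          refine ⟨fun ⟨hb, hlt⟩ => ⟨hb, ?_⟩, fun ⟨hb, hlt⟩ => ⟨hb, by omega⟩⟩
          rcases Nat.lt_succ_iff_lt_or_eq.mp hlt with hlt | hbl
          · exact hlt
          · have : b = ⟨l, hl⟩ := Fin.ext hbl
            exact absurd (htest.mpr (this ▸ hb)) hc
        refine Halts.mono (Halts.skip ?_) (by omega) fun _ h => h
        rw [hsame]
        exact ⟨by simpa using h7, by simpa [AuctionState] using hA⟩
    · rintro s' - ⟨h7, hA⟩
      unfold AuctionState at hA
      rw [h7, Finset.filter_true_of_mem fun b _ => b.2] at hA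
      exact hA.count_add_matchRank

end Correct

/-! ### Correctness of pricing, selection and the greedy loop -/

section Programs

variable {n m : ℕ} {g : Fin n → Fin m → Bool} {P : Finset (Fin m)} {s : Memory}
  {α : ℝ} {v : Fin n → ℝ} (hv : ∀ i, 0 ≤ v i)

theorem sellersExcept_self (m : ℕ) : sellersExcept m m = Finset.univ := by
  ext k
  simp [sellersExcept, k.2.ne]

theorem sellersExcept_val (j : Fin m) : sellersExcept m j = Finset.univ.erase j := by
  ext k
  simp [sellersExcept, Fin.ext_iff]

/-- Seller `j` is essential at a level iff excluding her makes more buyers give up. The loop keeps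
the largest value passing this test, and critical values are unique. -/
theorem priceProg_halts (h : Ready g P s) {j : Fin m} (hj : s.nat 14 0 = j) :
    Halts (realInput α v) priceProg (priceTime n m) s fun s' =>
      s'.real 0 0 = (homogeneous v hv g).price P j := by
  refine Halts.setReal_seq (Halts.forLoop (N := n)
    (T := (1 + (auctionTime n m + (1 + (1 + (auctionTime n m + 2))))))
    (fun l s' => 0 ≤ s'.real 0 0 ∧ (s'.real 0 0 = 0 ∨
        Essential (joinLink g P) (levelSet v (s'.real 0 0)) Finset.univ j) ∧
      ∀ i : Fin n, (i : ℕ) < l →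
        Essential (joinLink g P) (levelSet v (v i)) Finset.univ j → v i ≤ s'.real 0 0)
    (by simpa using h.buyers) (by decide) (by decide) (by decide) (by simp) ?_ ?_)
  · intro l hl s₁ hl₁ hF₁ ⟨h0, hatt, hup⟩
    have e₁ : ∀ a, a ∉ [5, 6, 7, 8, 9, 10, 11, 12, 13, 15, 19] → s₁.nat a = s.nat a := by
      intro a ha
      simp only [List.mem_cons, List.not_mem_nil, or_false, not_or] at ha
      rw [hF₁.1 a (by simp [forLoop, auctionProg, bidProg, cheapestProg, Program.natWrites, ha])]
      simp
    have eA : ∀ {s₂ s₃ : Memory}, auctionProg.Frame s₂ s₃ →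
        ∀ a, a ∉ [5, 6, 7, 8, 9, 10, 11, 15] → s₃.nat a = s₂.nat a := by
      intro s₂ s₃ hF a ha
      simp only [List.mem_cons, List.not_mem_nil, or_false, not_or] at ha
      exact hF.1 a (by simp [forLoop, auctionProg, bidProg, cheapestProg, Program.natWrites, ha])
    refine Halts.setNat_seq ?_
    have hR₁ : Ready g P s₁ := h.congr (e₁ _ (by decide)) (e₁ _ (by decide))
      (e₁ _ (by decide)) (e₁ _ (by decide))
    refine Halts.seq (auctionProg_halts (P := P) (i := ⟨l, hl⟩)
      (hR₁.congr (by simp) (by simp) (by simp) (by simp)) (by simpa using hl₁))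
      fun s₂ hs₂ hF₂ => Halts.setNat_seq (Halts.setNat_seq ?_)
    have e₂ := eA hF₂
    -- The index `m` belongs to no seller, so this first auction excludes nobody.
    have h13 : (s₁.setNat 13 ((NatExpr.const 0).eval s₁)
        ((NatExpr.get 0 (.const 1)).eval s₁)).nat 13 0 = m := by
      simpa using hR₁.sellers
    rw [h13, sellersExcept_self] at hs₂
    have e₂' : ∀ a, a ∉ [5, 6, 7, 8, 9, 10, 11, 13, 15] → s₂.nat a = s₁.nat a := by
      intro a ha
      simp only [List.mem_cons, List.not_mem_nil, or_false, not_or] at ha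
      rw [e₂ a (by simp [ha])]
      simp [ha]
    have hR₂ : Ready g P s₂ := hR₁.congr (e₂' _ (by decide)) (e₂' _ (by decide))
      (e₂' _ (by decide)) (e₂' _ (by decide))
    refine Halts.seq (auctionProg_halts (P := P) (i := ⟨l, hl⟩)
      (hR₂.congr (by simp) (by simp) (by simp) (by simp))
      (by simpa [e₂' 12 (by decide)] using hl₁)) fun s₃ hs₃ hF₃ => ?_
    have e₃ := eA hF₃
    have h14 : s₂.nat 14 0 = j := by rw [e₂' 14 (by decide), e₁ 14 (by decide), hj]
    simp [h14] at hs₃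
    rw [sellersExcept_val] at hs₃
    have h19 : s₃.nat 19 0 = s₂.nat 9 0 := by
      rw [e₃ 19 (by decide)]
      simp
    have h12 : s₃.nat 12 0 = l := by
      rw [e₃ 12 (by decide)]
      simp [e₂' 12 (by decide), hl₁]
    have hreal : s₃.real = s₁.real := by
      funext a
      rw [hF₃.2 a (by simp [forLoop, auctionProg, bidProg, cheapestProg, Program.realWrites])]
      simp only [Memory.setNat_real]
      rw [hF₂.2 a (by simp [forLoop, auctionProg, bidProg, cheapestProg, Program.realWrites])]
      simp
    have htest : Test.Holds (realInput α v) s₃ (.and (.natLE (.succ (.var 19)) (.var 9))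
          (.realLE (.get 0 (.const 0)) (.input (.succ (.var 12))))) ↔
        Essential (joinLink g P) (levelSet v (v ⟨l, hl⟩)) Finset.univ j ∧
          s₁.real 0 0 ≤ v ⟨l, hl⟩ := by
      simp only [Test.Holds, RealExpr.eval, NatExpr.succ, NatExpr.var, NatExpr.eval, h12, h19,
        hreal, realInput_succ α v hl, Essential]
      refine and_congr_left fun _ => ?_
      omega
    have hlt : ∀ i : Fin n, (i : ℕ) < l + 1 → (i : ℕ) < l ∨ i = ⟨l, hl⟩ := by
      intro k hk
      rcases Nat.lt_succ_iff_lt_or_eq.mp hk with hk | hk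
      · exact Or.inl hk
      · exact Or.inr (Fin.ext hk)
    refine Halts.ite (fun hc => Halts.setReal ?_) (fun hc => Halts.skip ?_)
    · obtain ⟨hess, hle⟩ := htest.mp hc
      have hval : RealExpr.eval (realInput α v) s₃ (.input (.succ (.var 12))) = v ⟨l, hl⟩ := by
        simp only [RealExpr.eval, NatExpr.succ, NatExpr.var, NatExpr.eval, h12,
          realInput_succ α v hl]
      rw [hval]
      simp only [Memory.setNat_real, Memory.setReal_real, NatExpr.eval, Function.update_self]
      refine ⟨hv _, Or.inr hess, fun i hi hi' => ?_⟩
      rcases hlt i hi with hi | rfl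
      · exact (hup i hi hi').trans hle
      · exact le_rfl
    · simp only [Memory.setNat_real, hreal]
      refine ⟨h0, hatt, fun i hi hi' => ?_⟩
      rcases hlt i hi with hi | rfl
      · exact hup i hi hi'
      · by_contra hle
        exact hc (htest.mpr ⟨hi', (not_le.mp hle).le⟩)
  · rintro s' - ⟨h0, hatt, hup⟩
    exact IsCritical.unique ⟨h0, hatt, fun i => hup i i.2⟩ (isCritical_price hv g P j)

theorem priceProg_frame {s s' : Memory} (h : priceProg.Frame s s') :
    (∀ a, a ∉ [5, 6, 7, 8, 9, 10, 11, 12, 13, 15, 19] → s'.nat a = s.nat a) ∧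
      s'.real 1 = s.real 1 := by
  refine ⟨fun a ha => ?_, h.2 1 (by decide)⟩
  simp only [List.mem_cons, List.not_mem_nil, or_false, not_or] at ha
  exact h.1 a (by
    simp [priceProg, forLoop, auctionProg, bidProg, cheapestProg, Program.natWrites, ha])

theorem selectProg_frame {s s' : Memory} (h : selectProg.Frame s s') {a : ℕ}
    (ha : a ∉ [5, 6, 7, 8, 9, 10, 11, 12, 13, 14, 15, 16, 17, 19]) : s'.nat a = s.nat a := by
  simp only [List.mem_cons, List.not_mem_nil, or_false, not_or] at ha
  exact h.1 a (by simp [selectProg, priceProg, forLoop, auctionProg, bidProg, cheapestProg,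
    Program.natWrites, ha])

theorem selectProg_halts (h : Ready g P s) :
    Halts (realInput α v) selectProg (selectTime n m) s fun s' =>
      (s'.nat 17 0 = 0 ∧ P = Finset.univ) ∨
      ∃ j : Fin m, s'.nat 17 0 = (j : ℕ) + 1 ∧ j ∉ P ∧
        s'.real 1 0 = (homogeneous v hv g).price P j ∧
        ∀ k ∉ P, (homogeneous v hv g).price P j ≤ (homogeneous v hv g).price P k := by
  refine Halts.setNat_seq (Halts.forLoop (N := m) (T := (1 + (priceTime n m + 3) + 1))
    (fun l s' => (s'.nat 17 0 = 0 ∧ ∀ k : Fin m, (k : ℕ) < l → k ∈ P) ∨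
      ∃ j : Fin m, s'.nat 17 0 = (j : ℕ) + 1 ∧ j ∉ P ∧
        s'.real 1 0 = (homogeneous v hv g).price P j ∧
        ∀ k ∉ P, (k : ℕ) < l → (homogeneous v hv g).price P j ≤ (homogeneous v hv g).price P k)
    (by simpa using h.sellers) (by decide) (by decide) (by decide) (by simp) ?_ ?_)
  · intro l hl s₁ hl₁ hF₁ hI
    have e₁ : ∀ a, a ∉ [5, 6, 7, 8, 9, 10, 11, 12, 13, 14, 15, 16, 17, 19] →
        s₁.nat a = s.nat a := by
      intro a ha
      simp only [List.mem_cons, List.not_mem_nil, or_false, not_or] at ha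
      rw [hF₁.1 a (by simp [priceProg, forLoop, auctionProg, bidProg, cheapestProg,
        Program.natWrites, ha])]
      simp [ha]
    have hR₁ : Ready g P s₁ := h.congr (e₁ _ (by decide)) (e₁ _ (by decide))
      (e₁ _ (by decide)) (e₁ _ (by decide))
    have hlt : ∀ i : Fin m, (i : ℕ) < l + 1 → (i : ℕ) < l ∨ i = ⟨l, hl⟩ := by
      intro k hk
      rcases Nat.lt_succ_iff_lt_or_eq.mp hk with hk | hk
      · exact Or.inl hk
      · exact Or.inr (Fin.ext hk)
    have hmem : Test.Holds (realInput α v) s₁ (.natLE (.get 2 (.var 16)) (.const 0)) ↔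
        (⟨l, hl⟩ : Fin m) ∉ P := by
      rw [← hR₁.platform, mem_outputSet]
      simp [hl₁]
    refine Halts.ite (fun hc => Halts.setNat_seq (Halts.seq
      (priceProg_halts hv (P := P) (j := ⟨l, hl⟩)
        (hR₁.congr (by simp) (by simp) (by simp) (by simp)) (by simp [hl₁]))
      fun s₂ hs₂ hF₂ => ?_)) (fun hc => ?_)
    · have hlP := hmem.mp hc
      obtain ⟨hF₂, hF₂'⟩ := priceProg_frame hF₂
      have h17 : s₂.nat 17 0 = s₁.nat 17 0 := by
        rw [hF₂ 17 (by decide)]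
        simp
      have h16 : s₂.nat 16 0 = l := by
        rw [hF₂ 16 (by decide)]
        simp [hl₁]
      have h1 : s₂.real 1 0 = s₁.real 1 0 := by
        rw [hF₂']
        simp
      refine Halts.ite (fun hc' => Halts.mono (Halts.skip ?_) one_le_two fun _ h => h)
        (fun hc' => Halts.setNat_seq (Halts.setReal ?_))
      · simp only [Test.Holds, NatExpr.eval, RealExpr.eval, NatExpr.var, h17, h1, hs₂] at hc'
        rcases hI with ⟨h0, -⟩ | ⟨j, hj, hjP, hjr, hmin⟩
        · omega
        · refine Or.inr ⟨j, by simp [h17, hj], hjP, by simp [h1, hjr], fun k hk hkl => ?_⟩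
          rcases hlt k hkl with hkl | rfl
          · exact hmin k hk hkl
          · rw [← hjr]
            exact hc'.2
      · refine Or.inr ⟨⟨l, hl⟩, by simp [h16], hlP, by simp [hs₂], fun k hk hkl => ?_⟩
        rcases hlt k hkl with hkl | rfl
        · simp only [Test.Holds, NatExpr.eval, RealExpr.eval, NatExpr.var, h17, h1, hs₂] at hc'
          rcases hI with ⟨h0, hall⟩ | ⟨j, hj, hjP, hjr, hmin⟩
          · exact absurd (hall k hkl) hk
          · have hle : ¬ s₁.real 1 0 ≤ (homogeneous v hv g).price P ⟨l, hl⟩ := fun hle =>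
              hc' ⟨by omega, hle⟩
            rw [hjr] at hle
            exact (not_le.mp hle).le.trans (hmin k hk hkl)
        · exact le_rfl
    · have hlP : (⟨l, hl⟩ : Fin m) ∈ P := by
        by_contra hn
        exact hc (hmem.mpr hn)
      refine Halts.mono (Halts.skip ?_) (by omega) fun _ h => h
      rcases hI with ⟨h0, hall⟩ | ⟨j, hj, hjP, hjr, hmin⟩
      · refine Or.inl ⟨by simp [h0], fun k hkl => ?_⟩
        rcases hlt k hkl with hkl | rfl
        · exact hall k hkl
        · exact hlP
      · refine Or.inr ⟨j, by simp [hj], hjP, by simp [hjr], fun k hk hkl => ?_⟩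
        rcases hlt k hkl with hkl | rfl
        · exact hmin k hk hkl
        · exact absurd hlP hk
  · rintro s' - (⟨h0, hall⟩ | ⟨j, hj, hjP, hjr, hmin⟩)
    · exact Or.inl ⟨h0, Finset.eq_univ_iff_forall.mpr fun k => hall k k.2⟩
    · exact Or.inr ⟨j, hj, hjP, hjr, fun k hk => hmin k hk k.2⟩

theorem outputSet_setNat_one (s : Memory) (j : Fin m) :
    outputSet m (s.setNat 2 j 1) = insert j (outputSet m s) := by
  ext k
  by_cases hk : k = j
  · subst hk
    simp [mem_outputSet]
  · have : (k : ℕ) ≠ j := fun h => hk (Fin.ext h)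
    simp [mem_outputSet, hk, this]

theorem outputSet_setNat_zero (s : Memory) (j : Fin m) :
    outputSet m (s.setNat 2 j 0) = (outputSet m s).erase j := by
  ext k
  by_cases hk : k = j
  · subst hk
    simp [mem_outputSet]
  · have : (k : ℕ) ≠ j := fun h => hk (Fin.ext h)
    simp [mem_outputSet, hk, this]

/-- The invariant of the main loop. -/
def GreedyState (g : Fin n → Fin m → Bool) (α : ℝ) (s : Memory) : Prop :=
  Ready g (outputSet m s) s ∧
    Relation.ReflTransGen ((homogeneous v hv g).GreedyStep α) ∅ (outputSet m s) ∧
    (s.nat 18 0 = 0 ∨ (outputSet m s = Finset.univ ∨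
      ∃ j, (homogeneous v hv g).IsSelected α (outputSet m s) j ∧
        (homogeneous v hv g).gain α (outputSet m s) j < 0))

/-- The number of passes through the main loop that are still possible. -/
def greedyPotential (m : ℕ) (s : Memory) : ℕ :=
  m - (outputSet m s).card + if s.nat 18 0 = 0 then 1 else 0

/-- The candidate joins tentatively so that her on-platform price can be computed; a negative gain
undoes this and sets the exit flag. So each pass enlarges the platform or ends the loop. -/
theorem stepProg_halts (hα : 0 ≤ α) (hα1 : α ≤ 1) (hs : GreedyState hv g α s)
    (h18 : s.nat 18 0 = 0) :
    Halts (realInput α v) stepProg (stepTime n m) s fun s' =>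
      GreedyState hv g α s' ∧ greedyPotential m s' < greedyPotential m s := by
  obtain ⟨hR, hrun, -⟩ := hs
  generalize hP : outputSet m s = P at *
  refine Halts.seq (selectProg_halts hv hR) fun s₁ hs₁ hF₁ => ?_
  have e₁ := fun a => selectProg_frame hF₁ (a := a)
  have hR₁ : Ready g P s₁ := hR.congr (e₁ _ (by decide)) (e₁ _ (by decide))
    (e₁ _ (by decide)) (e₁ _ (by decide))
  refine Halts.ite (fun hc => ?_) (fun hc => ?_)
  · rcases hs₁ with ⟨-, huniv⟩ | ⟨j, hj, -⟩
    · refine Halts.mono (Halts.setNat ?_) (by omega) fun _ h => h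
      have hout : outputSet m (s₁.setNat 18 0 1) = P :=
        (outputSet_congr (by simp)).trans hR₁.platform
      refine ⟨?_, ?_⟩
      · unfold GreedyState
        simp only [NatExpr.eval, hout]
        exact ⟨hR₁.congr (by simp) (by simp) (by simp) (by simp), hrun, Or.inr (Or.inl huniv)⟩
      · simp [greedyPotential, hout, hP, h18]
    · simp [hj] at hc
  · obtain ⟨j, hj, hjP, hjr, hmin⟩ := hs₁.resolve_left fun h => hc (by simp [h.1])
    have hsel : (homogeneous v hv g).IsSelected α P j :=
      (isSelected_iff hv g hα hα1).mpr ⟨hjP, hmin⟩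
    have hpred : ∀ s₂ : Memory, s₂.nat 17 0 = (j : ℕ) + 1 →
        (NatExpr.pred (.var 17)).eval s₂ = j := by
      intro s₂ h₂
      simp [h₂]
    have e18 : s₁.nat 18 0 = 0 := by rw [e₁ _ (by decide), h18]
    refine Halts.setNat_seq (Halts.setNat_seq ?_)
    rw [hpred s₁ hj, hpred _ (by simpa using hj)]
    simp only [NatExpr.eval]
    have hout : outputSet m ((s₁.setNat 2 j 1).setNat 14 0 j) = insert j P := by
      rw [outputSet_congr (s := s₁.setNat 2 j 1) (by simp), outputSet_setNat_one, hR₁.platform]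
    have hR₂ : Ready g (insert j P) ((s₁.setNat 2 j 1).setNat 14 0 j) :=
      ⟨by simpa using hR₁.buyers, by simpa using hR₁.sellers, by simpa using hR₁.graph,
        by simpa using hR₁.offset, hout⟩
    refine Halts.seq (priceProg_halts hv hR₂ (j := j) (by simp)) fun s₃ hs₃ hF₃ => ?_
    obtain ⟨hF₃, hF₃'⟩ := priceProg_frame hF₃
    have hR₃ : Ready g (insert j P) s₃ := hR₂.congr (hF₃ _ (by decide)) (hF₃ _ (by decide))
      (hF₃ _ (by decide)) (hF₃ _ (by decide))
    have h17 : s₃.nat 17 0 = (j : ℕ) + 1 := by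
      rw [hF₃ 17 (by decide)]
      simpa using hj
    have h18' : s₃.nat 18 0 = 0 := by
      rw [hF₃ 18 (by decide)]
      simpa using e18
    have htest : Test.Holds (realInput α v) s₃ (.realLE (.get 1 (.const 0))
        (.sub (.get 0 (.const 0)) (.scale (.const 0) (.get 0 (.const 0))))) ↔
        0 ≤ (homogeneous v hv g).gain α P j := by
      have h1 : s₃.real 1 0 = (homogeneous v hv g).price P j := by
        rw [hF₃']
        simpa using hjr
      simp only [Test.Holds, RealExpr.eval, NatExpr.eval, h1, hs₃, realInput, Network.gain,
        Network.onPrice, offPrice_of_notMem hjP]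
      constructor <;> intro h <;> linarith
    have hcard : P.card < m := by
      have := Finset.card_lt_univ_of_notMem hjP
      simpa using this
    refine Halts.ite (fun hc => Halts.mono (Halts.skip ?_) one_le_two fun _ h => h)
      (fun hc => Halts.setNat_seq (Halts.setNat ?_))
    · have hstep : (homogeneous v hv g).GreedyStep α P (insert j P) :=
        ⟨j, hsel, htest.mp hc, rfl⟩
      constructor
      · unfold GreedyState
        rw [hR₃.platform]
        exact ⟨hR₃, hrun.tail hstep, Or.inl h18'⟩
      · simp only [greedyPotential, hR₃.platform, hP, h18, h18',
          Finset.card_insert_of_notMem hjP]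
        omega
    · rw [hpred s₃ h17]
      simp only [NatExpr.eval]
      have hout' : outputSet m ((s₃.setNat 2 j 0).setNat 18 0 1) = P := by
        rw [outputSet_congr (s := s₃.setNat 2 j 0) (by simp), outputSet_setNat_zero, hR₃.platform,
          Finset.erase_insert hjP]
      constructor
      · unfold GreedyState
        rw [hout']
        exact ⟨⟨by simpa using hR₃.buyers, by simpa using hR₃.sellers, by simpa using hR₃.graph,
          by simpa using hR₃.offset, hout'⟩, hrun,
          Or.inr (Or.inr ⟨j, hsel, not_le.mp fun h => hc (htest.mpr h)⟩)⟩
      · simp [greedyPotential, hout', hP, h18]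

theorem initialMemory_graph (g : Fin n → Fin m → Bool) (i : Fin n) (j : Fin m) :
    (initialMemory g).nat 1 ((i : ℕ) * m + (j : ℕ)) = (g i j).toNat := by
  have he : (i : ℕ) * m + (j : ℕ) = (finProdFinEquiv (i, j) : ℕ) := by
    simp [finProdFinEquiv_apply_val]
    ring
  have hlt : (i : ℕ) * m + (j : ℕ) < n * m := he ▸ (finProdFinEquiv (i, j)).2
  have hx : (⟨(i : ℕ) * m + (j : ℕ), hlt⟩ : Fin (n * m)) = finProdFinEquiv (i, j) := Fin.ext he
  simp only [initialMemory, hlt, dif_pos, hx, Equiv.symm_apply_apply]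

theorem greedyProg_halts (hα : 0 ≤ α) (hα1 : α ≤ 1) :
    Halts (realInput α v) greedyProg (greedyTime n m) (initialMemory g) fun s =>
      (homogeneous v hv g).IsGreedyOutput α (outputSet m s) := by
  refine Halts.seq (Mid := fun s => ∀ i : Fin n, s.nat 3 i = (i : ℕ) * m) ?_
    fun s hs hF => ?_
  -- The row offsets `i * m` are built by repeated addition, as naturals cannot be multiplied.
  · refine Halts.forLoop (N := n) (T := 1)
      (fun l s' => ∀ i, i ≤ l → s'.nat 3 i = i * m) rfl (by decide) (by decide) (by decide)
      ?_ ?_ ?_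
    · intro i hi
      obtain rfl : i = 0 := by omega
      simp [initialMemory]
    · intro l hl s₁ hl₁ hF₁ hI
      refine Halts.setNat fun i hi => ?_
      have hm : s₁.nat 0 1 = m := by rw [hF₁.1 0 (by decide)]; rfl
      by_cases hil : i = l + 1
      · subst hil
        simp [hl₁, hm, hI l le_rfl]
        ring
      · have := hI i (by omega)
        simp [hl₁, hil, this]
    · exact fun s' _ hI i => hI i i.2.le
  · have e : ∀ a, a ≠ 3 → a ≠ 10 → s.nat a = (initialMemory g).nat a := by
      intro a h3 h10
      exact hF.1 a (by simp [forLoop, Program.natWrites, h3, h10])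
    have hout : outputSet m s = ∅ := by
      ext j
      rw [mem_outputSet, e 2 (by decide) (by decide)]
      simp [initialMemory]
    have h18 : s.nat 18 0 = 0 := by
      rw [e 18 (by decide) (by decide)]
      rfl
    refine Halts.while_of_variant (GreedyState hv g α) (greedyPotential m) ?_ ?_ ?_ ?_
    · unfold GreedyState
      rw [hout]
      refine ⟨⟨?_, ?_, ?_, hs, hout⟩, .refl, Or.inl h18⟩
      · rw [e 0 (by decide) (by decide)]; rfl
      · rw [e 0 (by decide) (by decide)]; rfl
      · rw [e 1 (by decide) (by decide)]; exact initialMemory_graph g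
    · simp [greedyPotential, hout, h18]
    · intro s' hs' hb _
      exact stepProg_halts hv hα hα1 hs' (by simpa using hb)
    · intro s' hs' hb
      exact ⟨hs'.2.1, hs'.2.2.resolve_left (by simpa using hb)⟩

end Programs

/-! ### The polynomial time bound -/

theorem greedyTime_mono {n m n' m' : ℕ} (hn : n ≤ n') (hm : m ≤ m') :
    greedyTime n m ≤ greedyTime n' m' := by
  unfold greedyTime stepTime selectTime priceTime auctionTime bidTime cheapestTime
  gcongr

/-- Both sizes are replaced by the single variable; monotonicity then bounds the time for `n`, `m`
by the value at `n + m`. -/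
theorem eval_greedyTime (N : ℕ) :
    (greedyTime (Polynomial.X : Polynomial ℕ) Polynomial.X).eval N = greedyTime N N := by
  simp [greedyTime, stepTime, selectTime, priceTime, auctionTime, bidTime, cheapestTime]

end PlatformMarket

theorem mainTheorem4 :
    (∀ (n m : ℕ) (v : Fin n → ℝ) (hv : ∀ i, 0 ≤ v i) (g : Fin n → Fin m → Bool) (α : ℝ),
      0 ≤ α → α ≤ 1 →
        (∀ Q : Finset (Fin m),
          IsGreatest ((PlatformMarket.homogeneous v hv g).join Q).competitivePrices
            ((PlatformMarket.homogeneous v hv g).price Q)) ∧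
        (∀ P, Relation.ReflTransGen ((PlatformMarket.homogeneous v hv g).GreedyStep α) ∅ P →
          ∃ P', Relation.ReflTransGen ((PlatformMarket.homogeneous v hv g).GreedyStep α) P P' ∧
            (PlatformMarket.homogeneous v hv g).IsGreedyOutput α P') ∧
        (∀ P, (PlatformMarket.homogeneous v hv g).IsGreedyOutput α P →
          (PlatformMarket.homogeneous v hv g).IsPurePlatformEquilibrium α P)) ∧
    (∃ (prog : PlatformMarket.Program) (q : Polynomial ℕ),
      ∀ (n m : ℕ) (v : Fin n → ℝ) (hv : ∀ i, 0 ≤ v i) (g : Fin n → Fin m → Bool) (α : ℝ),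
        0 ≤ α → α ≤ 1 →
          ∃ (t : ℕ) (s : PlatformMarket.Memory),
            PlatformMarket.Runs (PlatformMarket.realInput α v) prog
              (PlatformMarket.initialMemory g) t s ∧
            t ≤ q.eval (n + m) ∧
            (PlatformMarket.homogeneous v hv g).IsGreedyOutput α
              (PlatformMarket.outputSet m s)) := by
  refine ⟨fun n m v hv g α hα hα1 => ⟨PlatformMarket.isGreatest_price hv g,
    PlatformMarket.exists_greedy_completion hv g hα hα1,
    fun P => PlatformMarket.IsGreedyOutput.isPurePlatformEquilibrium hv g hα hα1⟩,
    PlatformMarket.greedyProg, PlatformMarket.greedyTime Polynomial.X Polynomial.X,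
    fun n m v hv g α hα hα1 => ?_⟩
  obtain ⟨t, s, hr, ht, hs⟩ := PlatformMarket.greedyProg_halts hv (g := g) hα hα1
  refine ⟨t, s, hr, ?_, hs⟩
  rw [PlatformMarket.eval_greedyTime]
  exact ht.trans (PlatformMarket.greedyTime_mono (Nat.le_add_right n m) (Nat.le_add_left m n))
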